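/- Setting. Base stations (BSs) form a homogeneous Poisson point process $\Phi$ of density $\lambda>0$ on $\mathbb{R}^2$; the typical mobile terminal is at the origin and is served by the nearest BS. All BSs transmit with power $P>0$, the path loss at distance $d$ is $d^{-\alpha}$ with $\alpha>2$, and the noise power is $\sigma_N^2\ge 0$. The power gain $g_0\ge 0$ of the serving channel and the i.i.d. power gains $g_b\ge 0$ of the interfering channels have mean one and arbitrary laws (the law of $g_0$ may differ from that of $g_b$); gains and locations are independent. Given that the serving BS is at distance $\xi$, the interferers are the points of $\Phi$ at distance $d_b>\xi$, so that the average rate is $$\mathcal R = 2\pi\lambda\int_0^\infty \xi e^{-\pi\lambda\xi^2}\,\mathbb E\Big\{\ln\Big(1+\frac{P g_0\xi^{-\alpha}}{\sigma_N^2+I_{\rm agg}(\xi)}\Big)\Big\}\,d\xi,\qquad I_{\rm agg}(\xi)=\sum_{b\in\Phi,\ d_b>\xi}P g_b d_b^{-\alpha}.$$ Put $\mathcal M_0(s)=\mathbb E\{e^{-s g_0}\}$, $\mathcal M_I(s)=\mathbb E\{e^{-s g_b}\}$, $\mathcal M_I^{(k)}(s)=\mathbb E\{g_b^{k+1}e^{-s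 g_b}\}$, and $$\mathcal Z_I(y)=\mathcal M_I(y)+\Gamma\big(1-\tfrac2\alpha\big)\sum_{k=0}^\infty \frac{y^{k+1}\mathcal M_I^{(k)}(y)}{\Gamma\big(2-\frac2\alpha+k\big)}.$$ Claim. The interference-limited rate, that is, the average rate for $\sigma_N^2=0$, is $$\mathcal R\big|_{\sigma_N^2=0}=\mathcal R^{({\rm SNR}_\infty)}=\int_0^\infty\frac{1-\mathcal M_0(z)}{\mathcal Z_I(z)}\,\frac{dz}{z},$$ and for $\sigma_N^2>0$ and ${\rm SNR}=P/\sigma_N^2$ the average rate satisfies $$\mathcal R^{({\rm SNR}\gg1)}:=\mathcal R^{({\rm SNR}_\infty)}-(\pi\lambda)^{-\alpha/2}\,\Gamma\big(1+\tfrac\alpha2\big)\,\frac1{\rm SNR}\int_0^\infty\frac{1-\mathcal M_0(z)}{\mathcal Z_I(z)^{1+\alpha/2}}\,dz\ \le\ \mathcal R({\rm SNR})\ \le\ \mathcal R^{({\rm SNR}_\infty)},$$ where the series (for every $y>0$), all the integrals and the expectations (for every $\xi>0$) converge. The lower bound is a high-SNR approximation of the average rate: $\mathcal R^{({\rm SNR}\gg1)}\to\mathcal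 R^{({\rm SNR}_\infty)}$ and $\mathcal R({\rm SNR})\to\mathcal R^{({\rm SNR}_\infty)}$ as ${\rm SNR}\to\infty$. -/

import Mathlib

open MeasureTheory ProbabilityTheory Set Filter Topology
open scoped ENNReal NNReal

noncomputable section

namespace CellularRate

/-- The plane in which the base stations (BSs) lie, with the Euclidean norm. The typical mobile
terminal is at the origin. -/
abbrev Plane : Type := EuclideanSpace ℝ (Fin 2)

/-- The number of indices `n` (a value in `[0, ∞]`) for which the point `X n ω` lies in `B`. -/
def pointCount {Ω : Type*} (X : ℕ → Ω → Plane) (B : Set Plane) (ω : Ω) : ℝ≥0∞ :=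
  ∑' n, B.indicator (fun _ => (1 : ℝ≥0∞)) (X n ω)

/-- The random points `X 0, X 1, …` are the points of a homogeneous Poisson point process (PPP) of
density `dens` on the plane: the number of points in a measurable set `B` of finite area has the
Poisson law with mean `dens * area B`, and the numbers of points in pairwise disjoint measurable
sets are independent. For `dens > 0` the process has almost surely infinitely many points, so that
enumerating them by `ℕ` is no restriction. -/
structure IsHomogeneousPPP {Ω : Type*} [MeasurableSpace Ω] (μ : Measure Ω) (dens : ℝ)
    (X : ℕ → Ω → Plane) : Prop where
  measurable : ∀ n, Measurable (X n)
  count_law : ∀ B : Set Plane, MeasurableSet B → volume B ≠ ∞ →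
    HasLaw (pointCount X B)
      ((poissonMeasure (dens * (volume B).toReal).toNNReal).map (fun k : ℕ => (k : ℝ≥0∞))) μ
  count_indep : ∀ (m : ℕ) (B : Fin m → Set Plane), (∀ i, MeasurableSet (B i)) →
    Pairwise (fun i j => Disjoint (B i) (B j)) → iIndepFun (fun i => pointCount X (B i)) μ

/-- A law of a power channel gain: a probability law on `[0, ∞)` with mean one. -/
structure IsGainLaw (ν : Measure ℝ) : Prop where
  isProbability : IsProbabilityMeasure ν
  nonneg : ∀ᵐ x ∂ν, 0 ≤ x
  integrable : Integrable (fun x : ℝ => x) ν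
  mean_one : ∫ x, x ∂ν = 1

/-- The randomness of a single-tier downlink network: the locations `X n` of the BSs form a
homogeneous PPP of density `dens`, the power gains `g n` of their channels are i.i.d. with law `νI`,
the power gain `g₀` of the channel of the serving BS has law `ν₀`, and locations, interfering gains
and serving gain are independent of each other. -/
structure IsSingleTierNetwork {Ω : Type*} [MeasurableSpace Ω] (μ : Measure Ω) (dens : ℝ)
    (ν₀ νI : Measure ℝ) (X : ℕ → Ω → Plane) (g : ℕ → Ω → ℝ) (g₀ : Ω → ℝ) : Prop where
  ppp : IsHomogeneousPPP μ dens X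
  gain_measurable : ∀ n, Measurable (g n)
  gain_law : ∀ n, HasLaw (g n) νI μ
  gain_indep : iIndepFun g μ
  serving_measurable : Measurable g₀
  serving_law : HasLaw g₀ ν₀ μ
  indep_locations_gains : IndepFun (fun ω n => X n ω) (fun ω n => g n ω) μ
  indep_serving : IndepFun g₀ (fun ω => ((fun n => X n ω), (fun n => g n ω))) μ

/-- The aggregate interference at the origin given that the serving (nearest) BS is at distance
`ξ`: the total received power from all the BSs that are farther away than `ξ`, with transmit power
`P` and path loss `d ↦ d ^ (-α)`. It is a sum of nonnegative terms, with value in `[0, ∞]`. -/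
def aggInterference {Ω : Type*} (α P ξ : ℝ) (X : ℕ → Ω → Plane) (g : ℕ → Ω → ℝ) (ω : Ω) : ℝ≥0∞ :=
  ∑' n, if ξ < ‖X n ω‖ then ENNReal.ofReal (P * g n ω * ‖X n ω‖ ^ (-α)) else 0

/-- The signal-to-interference-plus-noise ratio given that the serving BS is at distance `ξ`,
with noise power `noise`. -/
def sinr {Ω : Type*} (α P noise ξ : ℝ) (X : ℕ → Ω → Plane) (g : ℕ → Ω → ℝ) (g₀ : Ω → ℝ)
    (ω : Ω) : ℝ :=
  (ENNReal.ofReal (P * g₀ ω * ξ ^ (-α)) /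
    (ENNReal.ofReal noise + aggInterference α P ξ X g ω)).toReal

/-- The average rate given that the serving BS is at distance `ξ`. -/
def conditionalRate {Ω : Type*} [MeasurableSpace Ω] (μ : Measure Ω) (α P noise : ℝ)
    (X : ℕ → Ω → Plane) (g : ℕ → Ω → ℝ) (g₀ : Ω → ℝ) (ξ : ℝ) : ℝ :=
  ∫ ω, Real.log (1 + sinr α P noise ξ X g g₀ ω) ∂μ

/-- The average rate: the conditional rate averaged over the distance `ξ` of the serving BS, which
has the probability density `2 π dens ξ exp (-π dens ξ ^ 2)`. -/
def averageRate {Ω : Type*} [MeasurableSpace Ω] (μ : Measure Ω) (α dens P noise : ℝ)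
    (X : ℕ → Ω → Plane) (g : ℕ → Ω → ℝ) (g₀ : Ω → ℝ) : ℝ :=
  2 * Real.pi * dens * ∫ ξ in Ioi (0 : ℝ),
    ξ * Real.exp (-Real.pi * dens * ξ ^ 2) * conditionalRate μ α P noise X g g₀ ξ

/-- The moment generating function `s ↦ E (exp (-s G))` of a gain `G` with law `ν`. -/
def gainMGF (ν : Measure ℝ) (s : ℝ) : ℝ := ∫ x, Real.exp (-(s * x)) ∂ν

/-- `E (G ^ (k + 1) exp (-s G))` for a gain `G` with law `ν`. -/
def gainMoment (ν : Measure ℝ) (k : ℕ) (s : ℝ) : ℝ := ∫ x, x ^ (k + 1) * Real.exp (-(s * x)) ∂ν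

/-- The `k`-th term of the series that defines `T_I`. -/
def seriesTerm (α : ℝ) (ν : Measure ℝ) (y : ℝ) (k : ℕ) : ℝ :=
  y ^ (k + 1) * gainMoment ν k y * (Real.Gamma (2 - 2 / α + k))⁻¹

/-- The function `T_I`. -/
def T (α : ℝ) (ν : Measure ℝ) (y : ℝ) : ℝ := Real.Gamma (1 - 2 / α) * ∑' k, seriesTerm α ν y k

/-- The function `Z_I = M_I + T_I`. -/
def Z (α : ℝ) (ν : Measure ℝ) (y : ℝ) : ℝ := gainMGF ν y + T α ν y

/-- The closed form of the interference-limited rate. -/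
def rateLimit (α : ℝ) (ν₀ νI : Measure ℝ) : ℝ :=
  ∫ z in Ioi (0 : ℝ), (1 - gainMGF ν₀ z) / Z α νI z / z

/-- The high-SNR approximation of the average rate. -/
def highSNRRate (α dens : ℝ) (ν₀ νI : Measure ℝ) (snr : ℝ) : ℝ :=
  rateLimit α ν₀ νI - (Real.pi * dens) ^ (-(α / 2)) * Real.Gamma (1 + α / 2) * (1 / snr) *
    ∫ z in Ioi (0 : ℝ), (1 - gainMGF ν₀ z) / Z α νI z ^ (1 + α / 2)

end CellularRate

end

/-! For `x ≥ 0` and `y > 0`, `ln (1 + x / y)` is the integral over `z > 0` of `(1 - exp (-z x)) / z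
* exp (-z y)`. Dividing signal, noise and interference by `P ξ ^ (-α)`, take `x = g₀` and `y = η ξ ^
α + I`, where `η = 1 / SNR` and `I` is the rescaled interference. By independence the conditional
rate becomes the integral of `(1 - M₀ z) / z * exp (-η ξ ^ α z) * E exp (-z I)`.

The Laplace functional of the marked Poisson process gives `E exp (-z I) = exp (-π dens ξ ^ 2 (Z z -
1))`. A layer-cake computation expresses `Z - 1` as a mean of `excess`, and expanding an incomplete
gamma integral identifies it with the series (`IsGainLaw.Z_eq`).

Averaging over `ξ` leaves the integral of `ξ exp (-b ξ ^ 2) exp (-η ξ ^ α z)` with `b = π dens Z z`.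
For `η = 0` it is `1 / (2 b)`, which yields the noiseless rate. For `η ≥ 0` the inequalities `1 - u
≤ exp (-u) ≤ 1` yield both bounds, the linear term being a Gaussian moment of order `α + 1`.
Convergence rests on `Z ≥ 1`, `Z z ≥ c z ^ (2 / α)` and `1 - M₀ z ≤ min 1 z`.

The computation runs in `[0, ∞]`, where Tonelli needs no integrability and the interference may be
infinite; real-valued statements follow once the totals are finite. -/

namespace CellularRate

/-! ### Laplace functionals of plain and marked Poisson processes. -/

section LaplaceFunctional

/-- The function `t ↦ exp (-t)` on `[0, ∞]`. -/
noncomputable def expNeg (t : ℝ≥0∞) : ℝ≥0∞ := EReal.exp (-(t : EReal))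

lemma continuous_expNeg : Continuous expNeg :=
  ENNReal.continuous_exp.comp (continuous_neg.comp continuous_coe_ennreal_ereal)

lemma measurable_expNeg : Measurable expNeg := continuous_expNeg.measurable

@[simp] lemma expNeg_zero : expNeg 0 = 1 := by simp [expNeg]

@[simp] lemma expNeg_top : expNeg ∞ = 0 := by simp [expNeg]

lemma expNeg_add (a b : ℝ≥0∞) : expNeg (a + b) = expNeg a * expNeg b := by
  rw [expNeg, expNeg, expNeg, ← EReal.exp_add, EReal.coe_ennreal_add, EReal.neg_add]
  · rfl
  · simp
  · simp

lemma expNeg_sum {ι : Type*} (s : Finset ι) (a : ι → ℝ≥0∞) :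
    expNeg (∑ i ∈ s, a i) = ∏ i ∈ s, expNeg (a i) := by
  classical
  induction s using Finset.induction_on with
  | empty => simp
  | insert i s hi ih => rw [Finset.sum_insert hi, Finset.prod_insert hi, expNeg_add, ih]

lemma expNeg_ofReal {x : ℝ} (hx : 0 ≤ x) :
    expNeg (ENNReal.ofReal x) = ENNReal.ofReal (Real.exp (-x)) := by
  rw [expNeg, EReal.coe_ennreal_ofReal, max_eq_left hx, ← EReal.coe_neg, EReal.exp_coe]

lemma antitone_expNeg : Antitone expNeg := by
  intro a b h
  apply EReal.exp_monotone
  simpa using h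

lemma expNeg_le_one (t : ℝ≥0∞) : expNeg t ≤ 1 := by
  simpa using antitone_expNeg (zero_le (a := t))

/-- A right inverse of `expNeg` on `[0, 1]`. -/
noncomputable def negLog (p : ℝ≥0∞) : ℝ≥0∞ := (-(ENNReal.log p)).toENNReal

lemma measurable_negLog : Measurable negLog :=
  (continuous_neg.measurable.comp ENNReal.measurable_log).ereal_toENNReal

lemma expNeg_negLog {p : ℝ≥0∞} (hp : p ≤ 1) : expNeg (negLog p) = p := by
  rw [expNeg, negLog, EReal.coe_toENNReal, neg_neg, ENNReal.exp_log]
  rw [EReal.neg_nonneg]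
  simpa using hp

lemma tendsto_prod_expNeg (a : ℕ → ℝ≥0∞) :
    Tendsto (fun N => ∏ n ∈ Finset.range N, expNeg (a n)) atTop (𝓝 (expNeg (∑' n, a n))) := by
  simp_rw [← expNeg_sum]
  exact (continuous_expNeg.tendsto _).comp (ENNReal.tendsto_nat_tsum a)

/-- The factor `exp (-c k)` is absorbed into the `k`-th power of the Poisson weight, and the
exponential series sums the result. -/
lemma lintegral_expNeg_poisson (r : ℝ≥0) {c : ℝ≥0∞} (hc : c ≠ ∞) :
    ∫⁻ k, expNeg (c * k) ∂((poissonMeasure r).map (fun k : ℕ => (k : ℝ≥0∞))) =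
      expNeg (r * (1 - expNeg c)) := by
  have hm : Measurable fun k => expNeg (c * k) := measurable_expNeg.comp (by fun_prop)
  rw [lintegral_map hm (by fun_prop), lintegral_countable']
  set x := c.toReal with hx
  have hx0 : 0 ≤ x := ENNReal.toReal_nonneg
  have hcx : c = ENNReal.ofReal x := (ENNReal.ofReal_toReal hc).symm
  have h1 : ∀ k : ℕ, expNeg (c * k) * poissonMeasure r {k} =
      ENNReal.ofReal (Real.exp (-r) * ((r * Real.exp (-x)) ^ k / (k.factorial))) := by
    intro k
    rw [poissonMeasure_singleton, hcx, ← ENNReal.ofReal_natCast, ← ENNReal.ofReal_mul hx0,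
      expNeg_ofReal (by positivity), ← ENNReal.ofReal_mul (Real.exp_pos _).le]
    congr 1
    rw [mul_pow, ← Real.exp_nat_mul]
    ring_nf
  simp_rw [h1]
  have hs : HasSum (fun k : ℕ => Real.exp (-r) * ((r * Real.exp (-x)) ^ k / (k.factorial)))
      (Real.exp (-r) * Real.exp (r * Real.exp (-x))) := by
    have := NormedSpace.expSeries_div_hasSum_exp ((r : ℝ) * Real.exp (-x))
    rw [← Real.exp_eq_exp_ℝ] at this
    exact this.mul_left _
  rw [← ENNReal.ofReal_tsum_of_nonneg (fun k => by positivity) hs.summable, hs.tsum_eq, hcx,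
    expNeg_ofReal hx0, ← ENNReal.ofReal_one, ← ENNReal.ofReal_sub _ (Real.exp_pos _).le,
    ← ENNReal.ofReal_coe_nnreal (p := r), ← ENNReal.ofReal_mul r.coe_nonneg, expNeg_ofReal, ← Real.exp_add]
  · congr 2; ring
  · have : Real.exp (-x) ≤ 1 := by simpa using hx0
    exact mul_nonneg r.2 (by linarith)

variable {Ω : Type*} [MeasurableSpace Ω] {μ : Measure Ω} {dens : ℝ} {X : ℕ → Ω → Plane}

lemma measurable_pointCount (hX : IsHomogeneousPPP μ dens X) {B : Set Plane}
    (hB : MeasurableSet B) : Measurable (pointCount X B) :=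
  Measurable.tsum fun n => (measurable_const.indicator hB).comp (hX.measurable n)

/-- The Laplace functional of a homogeneous Poisson point process, for simple functions. -/
lemma IsHomogeneousPPP.lintegral_expNeg_tsum_simpleFunc [IsProbabilityMeasure μ]
    (hX : IsHomogeneousPPP μ dens X)
    (hd : 0 ≤ dens) (S : SimpleFunc Plane ℝ≥0∞) (hS : ∀ x, S x ≠ ∞)
    (hfin : ∀ c, c ≠ 0 → volume (S ⁻¹' {c}) ≠ ∞) :
    ∫⁻ ω, expNeg (∑' n, S (X n ω)) ∂μ =
      expNeg (ENNReal.ofReal dens * ∫⁻ x, (1 - expNeg (S x))) := by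
  classical
  let e := S.range.equivFin
  let c : Fin S.range.card → ℝ≥0∞ := fun i => (e.symm i : ℝ≥0∞)
  let B : Fin S.range.card → Set Plane := fun i => S ⁻¹' {c i}
  have hBm : ∀ i, MeasurableSet (B i) := fun i => S.measurableSet_fiber _
  have hcinj : Function.Injective c := Subtype.val_injective.comp e.symm.injective
  have hdis : Pairwise (fun i j => Disjoint (B i) (B j)) := by
    intro i j hij
    refine Set.disjoint_left.2 fun x hx hx' => hij (hcinj ?_)
    exact (show S x = c i from hx).symm.trans hx'
  have hex : ∀ x, ∃ i, S x = c i := fun x =>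
    ⟨e ⟨S x, S.mem_range_self x⟩, by simp [c]⟩
  have hcfin : ∀ i, c i ≠ ∞ := by
    intro i
    obtain ⟨x, hx⟩ := S.mem_range.1 (e.symm i).2
    exact fun h => hS x (hx.trans h)
  have hdec : ∀ (F : ℝ≥0∞ → ℝ≥0∞) (x : Plane),
      F (S x) = ∑ i, F (c i) * (B i).indicator (fun _ => (1 : ℝ≥0∞)) x := by
    intro F x
    obtain ⟨i, hi⟩ := hex x
    rw [Finset.sum_eq_single i]
    · have : x ∈ B i := hi
      simp [this, hi]
    · intro j _ hji
      have : x ∉ B j := fun h => hji (hcinj ((show S x = c j from h).symm.trans hi))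
      simp [this]
    · simp
  -- The fibres of `S` are disjoint, so their counts are independent and the expectation factors
  -- into Poisson transforms.
  have hsum : ∀ ω, ∑' n, S (X n ω) = ∑ i, c i * pointCount X (B i) ω := by
    intro ω
    calc ∑' n, S (X n ω)
        = ∑' n, ∑ i, c i * (B i).indicator (fun _ => (1 : ℝ≥0∞)) (X n ω) :=
          tsum_congr fun n => hdec id _
      _ = ∑ i, ∑' n, c i * (B i).indicator (fun _ => (1 : ℝ≥0∞)) (X n ω) :=
          Summable.tsum_finsetSum fun _ _ => ENNReal.summable
      _ = _ := Finset.sum_congr rfl fun i _ => by rw [ENNReal.tsum_mul_left]; rfl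
  have hterm : ∀ i, ∫⁻ ω, expNeg (c i * pointCount X (B i) ω) ∂μ =
      expNeg (ENNReal.ofReal dens * ((1 - expNeg (c i)) * volume (B i))) := by
    intro i
    -- The zero fibre may have infinite area, where `count_law` says nothing; it contributes the
    -- factor one.
    by_cases h0 : c i = 0
    · simp [h0]
    · have hv := hfin _ h0
      have := (hX.count_law (B i) (hBm i) hv).lintegral_comp
        (f := fun k => expNeg (c i * k)) (measurable_expNeg.comp (by fun_prop)).aemeasurable
      rw [this, lintegral_expNeg_poisson _ (hcfin i)]
      congr 1
      change ENNReal.ofReal _ * _ = _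
      rw [ENNReal.ofReal_mul hd, ENNReal.ofReal_toReal hv]
      ring
  simp_rw [hsum, expNeg_sum]
  have hind := (hX.count_indep _ B hBm hdis).comp (fun i k => expNeg (c i * k))
    (fun i => measurable_expNeg.comp (by fun_prop))
  have := lintegral_prod_eq_prod_lintegral_of_indepFun Finset.univ
    (fun i ω => expNeg (c i * pointCount X (B i) ω)) hind
    (fun i => measurable_expNeg.comp ((measurable_pointCount hX (hBm i)).const_mul _))
  rw [this]
  simp_rw [hterm, ← expNeg_sum, ← Finset.mul_sum]
  congr 2
  simp_rw [hdec (fun y => 1 - expNeg y)]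
  rw [lintegral_finsetSum _ fun i _ => (measurable_const.indicator (hBm i)).const_mul _]
  refine Finset.sum_congr rfl fun i _ => ?_
  rw [lintegral_const_mul _ (measurable_const.indicator (hBm i)), lintegral_indicator (hBm i)]
  simp

/-- The Laplace functional of a homogeneous Poisson point process. -/
lemma IsHomogeneousPPP.lintegral_expNeg_tsum [IsProbabilityMeasure μ]
    (hX : IsHomogeneousPPP μ dens X)
    (hd : 0 ≤ dens) {φ : Plane → ℝ≥0∞} (hφ : Measurable φ) :
    ∫⁻ ω, expNeg (∑' n, φ (X n ω)) ∂μ =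
      expNeg (ENNReal.ofReal dens * ∫⁻ x, (1 - expNeg (φ x))) := by
  -- Cutting off to balls gives every nonzero fibre finite area and keeps the approximation
  -- monotone.
  let S : ℕ → SimpleFunc Plane ℝ≥0∞ := fun j =>
    (SimpleFunc.eapprox φ j).restrict (Metric.ball 0 j)
  have hSapp : ∀ j x, S j x = (Metric.ball (0 : Plane) j).indicator (SimpleFunc.eapprox φ j) x :=
    fun j x => SimpleFunc.restrict_apply _ measurableSet_ball x
  have hmono : ∀ x, Monotone fun j => S j x := by
    intro x i j hij
    simp only [hSapp]
    refine (Set.indicator_le_indicator (SimpleFunc.monotone_eapprox φ hij x)).trans ?_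
    refine Set.indicator_le_indicator_of_subset (Metric.ball_subset_ball (by exact_mod_cast hij))
      (fun _ => zero_le) x
  have hlim : ∀ x, Tendsto (fun j => S j x) atTop (𝓝 (φ x)) := by
    intro x
    refine (SimpleFunc.tendsto_eapprox hφ x).congr' ?_
    obtain ⟨N, hN⟩ := exists_nat_gt ‖x‖
    filter_upwards [eventually_ge_atTop N] with j hj
    rw [hSapp, Set.indicator_of_mem]
    simpa using hN.trans_le (by exact_mod_cast hj)
  have hfun : ∀ j, ∫⁻ ω, expNeg (∑' n, S j (X n ω)) ∂μ =
      expNeg (ENNReal.ofReal dens * ∫⁻ x, (1 - expNeg (S j x))) := by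
    intro j
    refine hX.lintegral_expNeg_tsum_simpleFunc hd (S j) (fun x => ?_) (fun c hc => ?_)
    · rw [hSapp]
      by_cases hx : x ∈ Metric.ball (0 : Plane) j
      · rw [Set.indicator_of_mem hx]; exact (SimpleFunc.eapprox_lt_top φ j x).ne
      · rw [Set.indicator_of_notMem hx]; simp
    · refine ((measure_mono fun x hx => ?_).trans_lt
        (measure_ball_lt_top (x := (0 : Plane)) (r := j))).ne
      by_contra hxb
      apply hc
      have : S j x = c := hx
      rw [← this, hSapp, Set.indicator_of_notMem hxb]
  have hleft : Tendsto (fun j => ∫⁻ ω, expNeg (∑' n, S j (X n ω)) ∂μ) atTop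
      (𝓝 (∫⁻ ω, expNeg (∑' n, φ (X n ω)) ∂μ)) := by
    refine tendsto_lintegral_of_dominated_convergence (fun _ => 1) (fun j => ?_) (fun j => ?_)
      (by simp) (ae_of_all _ fun ω => ?_)
    · exact measurable_expNeg.comp
        (Measurable.tsum fun n => (S j).measurable.comp (hX.measurable n))
    · exact ae_of_all _ fun ω => expNeg_le_one _
    · refine (continuous_expNeg.tendsto _).comp ?_
      -- A sum over points is an integral against counting measure, so monotone convergence applies.
      simp_rw [← lintegral_count]
      exact lintegral_tendsto_of_tendsto_of_monotone
        (fun j => (measurable_of_countable _).aemeasurable)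
        (ae_of_all _ fun n => hmono _) (ae_of_all _ fun n => hlim _)
  have hright : Tendsto (fun j => expNeg (ENNReal.ofReal dens * ∫⁻ x, (1 - expNeg (S j x))))
      atTop (𝓝 (expNeg (ENNReal.ofReal dens * ∫⁻ x, (1 - expNeg (φ x))))) := by
    refine (continuous_expNeg.tendsto _).comp (ENNReal.Tendsto.const_mul ?_ (Or.inr (by simp)))
    refine lintegral_tendsto_of_tendsto_of_monotone (fun j => ?_)
      (ae_of_all _ fun x i j hij => ?_) (ae_of_all _ fun x => ?_)
    · exact (measurable_const.sub (measurable_expNeg.comp (S j).measurable)).aemeasurable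
    · exact tsub_le_tsub_left (antitone_expNeg (hmono x hij)) _
    · exact ENNReal.Tendsto.sub tendsto_const_nhds ((continuous_expNeg.tendsto _).comp (hlim x))
        (Or.inl (by simp))
  exact tendsto_nhds_unique hleft (by simpa only [hfun] using hright)

/-- The Laplace functional of a homogeneous Poisson point process with independent marks. -/
lemma IsHomogeneousPPP.lintegral_expNeg_tsum_marked [IsProbabilityMeasure μ]
    (hX : IsHomogeneousPPP μ dens X) (hd : 0 ≤ dens) {g : ℕ → Ω → ℝ} {ν : Measure ℝ}
    [IsProbabilityMeasure ν]
    (hgm : ∀ n, Measurable (g n)) (hgl : ∀ n, HasLaw (g n) ν μ) (hgi : iIndepFun g μ)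
    (hXg : IndepFun (fun ω n => X n ω) (fun ω n => g n ω) μ)
    {f : Plane → ℝ → ℝ≥0∞} (hf : Measurable (Function.uncurry f)) :
    ∫⁻ ω, expNeg (∑' n, f (X n ω) (g n ω)) ∂μ =
      expNeg (ENNReal.ofReal dens * ∫⁻ x, (1 - ∫⁻ y, expNeg (f x y) ∂ν)) := by
  let F : Plane → ℝ≥0∞ := fun x => ∫⁻ y, expNeg (f x y) ∂ν
  have hef : Measurable (Function.uncurry fun x y => expNeg (f x y)) := measurable_expNeg.comp hf
  have hFm : Measurable F := hef.lintegral_prod_right'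
  have hF1 : ∀ x, F x ≤ 1 := fun x => by
    refine (lintegral_mono fun y => expNeg_le_one _).trans ?_
    simp
  have hXm : Measurable fun ω n => X n ω := measurable_pi_lambda _ hX.measurable
  have hgm' : Measurable fun ω n => g n ω := measurable_pi_lambda _ hgm
  have hmeas : ∀ n, Measurable fun p : (ℕ → Plane) × (ℕ → ℝ) => expNeg (f (p.1 n) (p.2 n)) :=
    fun n => by
      have : Measurable fun p : (ℕ → Plane) × (ℕ → ℝ) => (p.1 n, p.2 n) := by fun_prop
      exact hef.comp this
  -- With the locations frozen, independent gains average out factor by factor. This is done for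
  -- finite products; the limit comes afterwards.
  have hstep : ∀ N : ℕ, ∫⁻ ω, ∏ n ∈ Finset.range N, expNeg (f (X n ω) (g n ω)) ∂μ =
      ∫⁻ ω, ∏ n ∈ Finset.range N, F (X n ω) ∂μ := by
    intro N
    have hpm : Measurable fun p : (ℕ → Plane) × (ℕ → ℝ) =>
        ∏ n ∈ Finset.range N, expNeg (f (p.1 n) (p.2 n)) :=
      Finset.measurable_prod _ fun n _ => hmeas n
    have h1 := (indepFun_iff_map_prod_eq_prod_map_map hXm.aemeasurable hgm'.aemeasurable).1 hXg
    rw [← lintegral_map hpm (hXm.prodMk hgm'), h1, lintegral_prod _ hpm.aemeasurable,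
      lintegral_map hpm.lintegral_prod_right' hXm]
    refine lintegral_congr fun ω => ?_
    have hfx : ∀ n, Measurable fun y => expNeg (f (X n ω) y) :=
      fun n => hef.comp measurable_prodMk_left
    have := lintegral_prod_eq_prod_lintegral_of_indepFun (Finset.range N)
      (fun n ω' => expNeg (f (X n ω) (g n ω')))
      (hgi.comp (fun n y => expNeg (f (X n ω) y)) hfx) (fun n => (hfx n).comp (hgm n))
    refine (lintegral_map (f := fun y : ℕ → ℝ => ∏ n ∈ Finset.range N, expNeg (f (X n ω) (y n)))
      (hpm.comp measurable_prodMk_left) hgm').trans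
      (this.trans (Finset.prod_congr rfl fun n _ => ?_))
    exact (hgl n).lintegral_comp (hfx n).aemeasurable
  have hl1 : Tendsto (fun N => ∫⁻ ω, ∏ n ∈ Finset.range N, expNeg (f (X n ω) (g n ω)) ∂μ) atTop
      (𝓝 (∫⁻ ω, expNeg (∑' n, f (X n ω) (g n ω)) ∂μ)) := by
    refine tendsto_lintegral_of_dominated_convergence (fun _ => 1) (fun N => ?_) (fun N => ?_)
      (by simp) (ae_of_all _ fun ω => tendsto_prod_expNeg _)
    · exact Finset.measurable_prod _ fun n _ => (hmeas n).comp (hXm.prodMk hgm')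
    · exact ae_of_all _ fun ω => Finset.prod_le_one' fun n _ => expNeg_le_one _
  -- Writing `F = exp (-φ)` with `φ = negLog F` reduces the marked functional to the unmarked one;
  -- `φ` is infinite where `F` vanishes.
  have hl2 : Tendsto (fun N => ∫⁻ ω, ∏ n ∈ Finset.range N, F (X n ω) ∂μ) atTop
      (𝓝 (∫⁻ ω, expNeg (∑' n, negLog (F (X n ω))) ∂μ)) := by
    refine tendsto_lintegral_of_dominated_convergence (fun _ => 1) (fun N => ?_) (fun N => ?_)
      (by simp) (ae_of_all _ fun ω => ?_)
    · exact Finset.measurable_prod _ fun n _ => hFm.comp (hX.measurable n)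
    · exact ae_of_all _ fun ω => Finset.prod_le_one' fun n _ => hF1 _
    · simpa only [expNeg_negLog (hF1 _)] using tendsto_prod_expNeg fun n => negLog (F (X n ω))
  simp_rw [hstep] at hl1
  rw [tendsto_nhds_unique hl1 hl2,
    hX.lintegral_expNeg_tsum hd (φ := fun x => negLog (F x)) (measurable_negLog.comp hFm)]
  simp_rw [expNeg_negLog (hF1 _)]
  rfl

end LaplaceFunctional

/-! ### Closed-form integrals: logarithm, Gaussian moments, incomplete gamma, interference area. -/

section ClosedForm

lemma lintegral_Ioo_mul_exp_neg {w b : ℝ} (hw : 0 ≤ w) (hb : 0 ≤ b) :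
    ∫⁻ t in Ioo 0 b, ENNReal.ofReal (w * Real.exp (-(w * t))) =
      ENNReal.ofReal (1 - Real.exp (-(w * b))) := by
  have hc : Continuous fun t : ℝ => w * Real.exp (-(w * t)) := by fun_prop
  have hint : IntegrableOn (fun t : ℝ => w * Real.exp (-(w * t))) (Ioc 0 b) :=
    (intervalIntegrable_iff_integrableOn_Ioc_of_le hb).1 (hc.intervalIntegrable 0 b)
  rw [Measure.restrict_congr_set Ioo_ae_eq_Ioc, ← ofReal_integral_eq_lintegral_ofReal hint
    (ae_of_all _ fun t => by positivity), ← intervalIntegral.integral_of_le hb,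
    intervalIntegral.integral_eq_sub_of_hasDerivAt (f := fun t => -Real.exp (-(w * t)))]
  · congr 1; simp; ring
  · intro t _
    have h1 : HasDerivAt (fun t : ℝ => -(w * t)) (-w) t := by
      simpa using! ((hasDerivAt_id t).const_mul w).neg
    simpa [mul_comm] using! h1.exp.neg
  · exact hc.intervalIntegrable 0 b

lemma lintegral_Ioi_exp_neg_mul {c : ℝ} (hc : 0 < c) :
    ∫⁻ z in Ioi 0, ENNReal.ofReal (Real.exp (-(c * z))) = ENNReal.ofReal (1 / c) := by
  have h : ∀ z : ℝ, -(c * z) = -c * z := fun z => by ring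
  simp_rw [h]
  rw [← ofReal_integral_eq_lintegral_ofReal (integrableOn_exp_mul_Ioi (by linarith) 0)
    (ae_of_all _ fun t => (Real.exp_pos _).le), integral_exp_mul_Ioi (by linarith)]
  simp

lemma lintegral_Ioo_one_div_add {x y : ℝ} (hx : 0 ≤ x) (hy : 0 < y) :
    ∫⁻ t in Ioo 0 x, ENNReal.ofReal (1 / (t + y)) = ENNReal.ofReal (Real.log (1 + x / y)) := by
  have hii : IntervalIntegrable (fun t : ℝ => 1 / (t + y)) volume 0 x := by
    refine ContinuousOn.intervalIntegrable ?_
    rw [Set.uIcc_of_le hx]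
    intro t ht
    have : t + y ≠ 0 := by have := ht.1; positivity
    exact ContinuousAt.continuousWithinAt (by fun_prop (disch := exact this))
  rw [Measure.restrict_congr_set Ioo_ae_eq_Ioc, ← ofReal_integral_eq_lintegral_ofReal
    ((intervalIntegrable_iff_integrableOn_Ioc_of_le hx).1 hii), ← intervalIntegral.integral_of_le hx,
    intervalIntegral.integral_comp_add_right (fun t => 1 / t), zero_add, integral_one_div_of_pos hy
    (by positivity)]
  · congr 2; field_simp; ring
  · filter_upwards [ae_restrict_mem measurableSet_Ioc] with t ht
    have := ht.1
    simp only [Pi.zero_apply]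
    positivity

/-- Frullani's argument: `(1 - exp (-z x)) / z` is the integral of `exp (-z t)` over `0 < t < x`;
after Tonelli the `z`-integral is `1 / (t + y)`. -/
lemma lintegral_one_sub_exp_div_mul_exp {x y : ℝ} (hx : 0 ≤ x) (hy : 0 < y) :
    ∫⁻ z in Ioi 0, ENNReal.ofReal ((1 - Real.exp (-(z * x))) / z * Real.exp (-(z * y))) =
      ENNReal.ofReal (Real.log (1 + x / y)) := by
  have h1 : ∀ z ∈ Ioi (0 : ℝ),
      ENNReal.ofReal ((1 - Real.exp (-(z * x))) / z * Real.exp (-(z * y))) =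
        ∫⁻ t in Ioo 0 x, ENNReal.ofReal (Real.exp (-((t + y) * z))) := by
    intro z hz
    have hz : 0 < z := hz
    have hle : Real.exp (-(z * x)) ≤ 1 := by simpa using mul_nonneg hz.le hx
    have : ∀ t, ENNReal.ofReal (Real.exp (-((t + y) * z))) =
        ENNReal.ofReal (Real.exp (-(z * y)) / z) *
          ENNReal.ofReal (z * Real.exp (-(z * t))) := fun t => by
      rw [← ENNReal.ofReal_mul (by positivity)]
      congr 1
      field_simp
      rw [← Real.exp_add]
      ring_nf
    simp_rw [this]
    rw [lintegral_const_mul' _ _ ENNReal.ofReal_ne_top, lintegral_Ioo_mul_exp_neg hz.le hx,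
      ← ENNReal.ofReal_mul (by positivity)]
    congr 1
    field_simp
  rw [setLIntegral_congr_fun measurableSet_Ioi h1, lintegral_lintegral_swap
    (by fun_prop), ← lintegral_Ioo_one_div_add hx hy]
  refine setLIntegral_congr_fun measurableSet_Ioo fun t ht => ?_
  exact lintegral_Ioi_exp_neg_mul (by have := ht.1; positivity)

/-- The integral representation of `ln (1 + x / y)`, for `y` in `(0, ∞]`. -/
lemma lintegral_one_sub_exp_div_mul_expNeg {x : ℝ} (hx : 0 ≤ x) {y : ℝ≥0∞} (hy : y ≠ 0) :
    ∫⁻ z in Ioi 0, ENNReal.ofReal ((1 - Real.exp (-(z * x))) / z) *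
        expNeg (ENNReal.ofReal z * y) =
      ENNReal.ofReal (Real.log (1 + (ENNReal.ofReal x / y).toReal)) := by
  by_cases htop : y = ∞
  · subst htop
    have : ∀ z ∈ Ioi (0 : ℝ), ENNReal.ofReal ((1 - Real.exp (-(z * x))) / z) *
        expNeg (ENNReal.ofReal z * ∞) = 0 := by
      intro z hz
      rw [ENNReal.mul_top (by simpa using hz)]
      simp
    rw [setLIntegral_congr_fun measurableSet_Ioi this]
    simp
  · have hy0 : 0 < y.toReal := ENNReal.toReal_pos hy htop
    rw [ENNReal.toReal_div, ENNReal.toReal_ofReal hx, ← lintegral_one_sub_exp_div_mul_exp hx hy0]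
    refine setLIntegral_congr_fun measurableSet_Ioi fun z hz => ?_
    have hz : 0 < z := hz
    have hle : Real.exp (-(z * x)) ≤ 1 := by simpa using mul_nonneg hz.le hx
    conv_lhs => rw [← ENNReal.ofReal_toReal htop]
    rw [← ENNReal.ofReal_mul hz.le, expNeg_ofReal (by positivity), ← ENNReal.ofReal_mul]
    exact div_nonneg (by linarith) hz.le

lemma lintegral_rpow_mul_exp_neg_mul_sq {q b : ℝ} (hq : -1 < q) (hb : 0 < b) :
    ∫⁻ ξ in Ioi 0, ENNReal.ofReal (ξ ^ q * Real.exp (-(b * ξ ^ 2))) =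
      ENNReal.ofReal (b ^ (-(q + 1) / 2) * (1 / 2) * Real.Gamma ((q + 1) / 2)) := by
  have h := integral_rpow_mul_exp_neg_mul_rpow (p := 2) two_pos hq hb
  have hcongr : ∀ ξ : ℝ, ξ ^ q * Real.exp (-(b * ξ ^ 2)) = ξ ^ q * Real.exp (-b * ξ ^ (2 : ℝ)) :=
    fun ξ => by rw [Real.rpow_two, neg_mul]
  simp_rw [hcongr]
  have hpos : 0 < b ^ (-(q + 1) / 2) * (1 / 2) * Real.Gamma ((q + 1) / 2) :=
    mul_pos (by positivity) (Real.Gamma_pos_of_pos (by linarith))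
  rw [← h, ofReal_integral_eq_lintegral_ofReal]
  -- A non-integrable function would have Bochner integral zero, contradicting the positive value.
  · by_contra hn
    exact hpos.ne' (h.symm.trans (integral_undef hn))
  · filter_upwards [ae_restrict_mem measurableSet_Ioi] with ξ hξ
    have : 0 < ξ := hξ
    simp only [Pi.zero_apply]
    positivity

/-- This is the beta integral, read off from the normalisation of the beta law with parameters `a`
and `k + 1`. -/
lemma lintegral_rpow_mul_one_sub_pow {a : ℝ} (ha : 0 < a) (k : ℕ) :
    ∫⁻ t in Ioo 0 1, ENNReal.ofReal (t ^ (a - 1) * (1 - t) ^ k) =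
      ENNReal.ofReal (Real.Gamma a * k.factorial / Real.Gamma (a + 1 + k)) := by
  have hk : (0 : ℝ) < k + 1 := by positivity
  have h := lintegral_betaPDF_eq_one ha hk
  have hbp := beta_pos ha hk
  rw [lintegral_betaPDF] at h
  have : ∀ t : ℝ, ENNReal.ofReal (1 / beta a (k + 1) * t ^ (a - 1) * (1 - t) ^ ((k : ℝ) + 1 - 1)) =
      ENNReal.ofReal (1 / beta a (k + 1)) * ENNReal.ofReal (t ^ (a - 1) * (1 - t) ^ k) := fun t => by
    rw [← ENNReal.ofReal_mul (by positivity), add_sub_cancel_right, Real.rpow_natCast, mul_assoc]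
  simp_rw [this] at h
  rw [lintegral_const_mul' _ _ ENNReal.ofReal_ne_top] at h
  have hb : Real.Gamma a * k.factorial / Real.Gamma (a + 1 + k) = beta a (k + 1) := by
    rw [beta, Real.Gamma_nat_eq_factorial]; ring_nf
  rw [hb, ← ENNReal.mul_right_inj (a := ENNReal.ofReal (1 / beta a (k + 1))) (by simpa using hbp)
    ENNReal.ofReal_ne_top, h, ← ENNReal.ofReal_mul (by positivity)]
  simp [hbp.ne']

/-- The lower incomplete gamma function as a power series. -/
lemma lintegral_mul_exp_neg_mul_rpow {a w : ℝ} (ha : 0 < a) (hw : 0 ≤ w) :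
    ∫⁻ t in Ioo 0 1, ENNReal.ofReal (w * Real.exp (-(w * t)) * t ^ (a - 1)) =
      ∑' k : ℕ, ENNReal.ofReal
        (Real.Gamma a * (w ^ (k + 1) * Real.exp (-w) * (Real.Gamma (a + 1 + k))⁻¹)) := by
  -- Expanding `exp (-w t) = exp (-w) * exp (w (1 - t))` in powers of `1 - t` keeps all terms
  -- nonnegative and produces the factor `exp (-w)` of the gain moments.
  have h : ∀ t ∈ Ioo (0 : ℝ) 1, ENNReal.ofReal (w * Real.exp (-(w * t)) * t ^ (a - 1)) =
      ∑' k : ℕ, ENNReal.ofReal (w ^ (k + 1) * Real.exp (-w) / k.factorial) *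
        ENNReal.ofReal (t ^ (a - 1) * (1 - t) ^ k) := by
    intro t ht
    have h0 := ht.1
    have h1 : 0 < 1 - t := by linarith [ht.2]
    have hs := NormedSpace.expSeries_div_hasSum_exp (w * (1 - t))
    rw [← Real.exp_eq_exp_ℝ] at hs
    have hs := hs.mul_left (w * Real.exp (-w) * t ^ (a - 1))
    have : ∀ k : ℕ, ENNReal.ofReal (w ^ (k + 1) * Real.exp (-w) / k.factorial) *
        ENNReal.ofReal (t ^ (a - 1) * (1 - t) ^ k) =
        ENNReal.ofReal (w * Real.exp (-w) * t ^ (a - 1) *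
          ((w * (1 - t)) ^ k / k.factorial)) := fun k => by
      rw [← ENNReal.ofReal_mul (by positivity)]
      congr 1
      rw [mul_pow]
      ring
    simp_rw [this]
    rw [← ENNReal.ofReal_tsum_of_nonneg (fun k => by positivity) hs.summable, hs.tsum_eq]
    congr 1
    have : Real.exp (-(w * t)) = Real.exp (-w) * Real.exp (w * (1 - t)) := by
      rw [← Real.exp_add]; ring_nf
    rw [this]
    ring
  rw [setLIntegral_congr_fun measurableSet_Ioo h, lintegral_tsum (fun k => by fun_prop)]
  refine tsum_congr fun k => ?_
  have hG : 0 < Real.Gamma (a + 1 + k) := Real.Gamma_pos_of_pos (by positivity)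
  rw [lintegral_const_mul' _ _ ENNReal.ofReal_ne_top, lintegral_rpow_mul_one_sub_pow ha,
    ← ENNReal.ofReal_mul (by positivity)]
  congr 1
  field_simp

/-- A bound linear in `w`, so that a finite mean gain suffices for finiteness of `gainExcess`. -/
lemma lintegral_mul_exp_neg_mul_rpow_le {a w : ℝ} (ha : 0 < a) (hw : 0 ≤ w) :
    ∫⁻ t in Ioo 0 1, ENNReal.ofReal (w * Real.exp (-(w * t)) * t ^ (a - 1)) ≤
      ENNReal.ofReal w * ENNReal.ofReal (Real.Gamma a / Real.Gamma (a + 1)) := by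
  have h := lintegral_rpow_mul_one_sub_pow ha 0
  simp only [pow_zero, mul_one, Nat.factorial_zero, Nat.cast_one, Nat.cast_zero, add_zero] at h
  rw [← h, ← lintegral_const_mul' _ _ ENNReal.ofReal_ne_top]
  refine setLIntegral_mono' measurableSet_Ioo fun t ht => ?_
  have h0 := ht.1
  rw [← ENNReal.ofReal_mul hw]
  refine ENNReal.ofReal_le_ofReal ?_
  have : Real.exp (-(w * t)) ≤ 1 := by simpa using mul_nonneg hw h0.le
  have h2 : 0 ≤ w * t ^ (a - 1) := by positivity
  nlinarith

/-- The integral of `w exp (-w t) (t ^ (-2 / α) - 1)` over the unit interval. -/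
noncomputable def excess (α w : ℝ) : ℝ≥0∞ :=
  ∫⁻ t in Ioo 0 1, ENNReal.ofReal (w * Real.exp (-(w * t)) * (t ^ (-(2 / α)) - 1))

lemma measurable_excess (α : ℝ) : Measurable (excess α) := by
  unfold excess
  exact Measurable.lintegral_prod_right' (f := fun p : ℝ × ℝ =>
    ENNReal.ofReal (p.1 * Real.exp (-(p.1 * p.2)) * (p.2 ^ (-(2 / α)) - 1))) (by fun_prop)

variable {α : ℝ}

lemma one_le_rpow_neg (hα : 2 < α) {t : ℝ} (ht : t ∈ Ioo (0 : ℝ) 1) : 1 ≤ t ^ (-(2 / α)) :=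
  Real.one_le_rpow_of_pos_of_le_one_of_nonpos ht.1 ht.2.le (by simp; positivity)

/-- The `-1` in `excess` integrates to `1 - exp (-w)`; restoring it leaves an incomplete gamma
integral with parameter `1 - 2 / α`. -/
lemma excess_add (hα : 2 < α) {w : ℝ} (hw : 0 ≤ w) :
    excess α w + ENNReal.ofReal (1 - Real.exp (-w)) =
      ∫⁻ t in Ioo 0 1, ENNReal.ofReal (w * Real.exp (-(w * t)) * t ^ ((1 - 2 / α) - 1)) := by
  have h := lintegral_Ioo_mul_exp_neg hw zero_le_one
  rw [mul_one] at h
  rw [← h, excess, ← lintegral_add_left (by fun_prop)]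
  refine setLIntegral_congr_fun measurableSet_Ioo fun t ht => ?_
  have h1 := one_le_rpow_neg hα ht
  rw [← ENNReal.ofReal_add (mul_nonneg (by positivity) (by linarith)) (by positivity)]
  congr 1
  have : (1 - 2 / α) - 1 = -(2 / α) := by ring
  rw [this]
  ring

/-- The second condition means `‖x‖ < ξ t ^ (-1 / α)`, so the set is an annulus. -/
lemma volume_annulus (hα : 2 < α) {ξ t : ℝ} (hξ : 0 < ξ) (ht : t ∈ Ioo (0 : ℝ) 1) :
    volume {x : Plane | ξ < ‖x‖ ∧ t < (‖x‖ / ξ) ^ (-α)} =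
      ENNReal.ofReal (Real.pi * ξ ^ 2) * ENNReal.ofReal (t ^ (-(2 / α)) - 1) := by
  have hα0 : 0 < α := by linarith
  have ht0 := ht.1
  have hr : ξ < ξ * t ^ (-(1 / α)) := by
    have : 1 < t ^ (-(1 / α)) :=
      Real.one_lt_rpow_of_pos_of_lt_one_of_neg ht.1 ht.2 (by simp; positivity)
    nlinarith
  have hset : {x : Plane | ξ < ‖x‖ ∧ t < (‖x‖ / ξ) ^ (-α)} =
      Metric.ball 0 (ξ * t ^ (-(1 / α))) \ Metric.closedBall 0 ξ := by
    ext x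
    simp only [mem_ofPred_eq, Set.mem_sdiff, mem_ball_zero_iff, mem_closedBall_zero_iff, not_le]
    rw [and_comm]
    refine and_congr_left fun hx => ?_
    have hx0 : 0 < ‖x‖ / ξ := div_pos (hξ.trans hx) hξ
    rw [← Real.lt_rpow_inv_iff_of_neg hx0 ht0 (by linarith), div_lt_iff₀' hξ, inv_neg, one_div]
  rw [hset, measure_sdiff (Metric.closedBall_subset_ball hr) Metric.isClosed_closedBall.measurableSet.nullMeasurableSet
    (by exact measure_closedBall_lt_top.ne), EuclideanSpace.volume_ball_fin_two,
    EuclideanSpace.volume_closedBall_fin_two, ← ENNReal.ofReal_pow (by positivity),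
    ← ENNReal.ofReal_pow hξ.le, ← ENNReal.ofReal_mul (by positivity),
    ← ENNReal.ofReal_mul (by positivity), ← ENNReal.ofReal_sub _ (by positivity),
    ← ENNReal.ofReal_mul (by positivity)]
  · congr 1
    rw [mul_pow, ← Real.rpow_natCast (t ^ _), ← Real.rpow_mul ht0.le]
    push_cast
    rw [show -(1 / α) * 2 = -(2 / α) by ring]
    ring

/-- Layer cake: `1 - exp (-w ρ)` is the integral of `w exp (-w t)` over `0 < t < ρ`, and Tonelli
turns the plane integral into areas of annuli. -/
lemma lintegral_one_sub_exp_neg_norm (hα : 2 < α) {ξ w : ℝ} (hξ : 0 < ξ) (hw : 0 ≤ w) :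
    ∫⁻ x : Plane, (if ξ < ‖x‖ then ENNReal.ofReal (1 - Real.exp (-(w * (‖x‖ / ξ) ^ (-α)))) else 0) =
      ENNReal.ofReal (Real.pi * ξ ^ 2) * excess α w := by
  have h1 : ∀ x : Plane,
      (if ξ < ‖x‖ then ENNReal.ofReal (1 - Real.exp (-(w * (‖x‖ / ξ) ^ (-α)))) else 0) =
        ∫⁻ t in Ioo 0 1, ENNReal.ofReal (w * Real.exp (-(w * t))) *
          {p : Plane × ℝ | ξ < ‖p.1‖ ∧ p.2 < (‖p.1‖ / ξ) ^ (-α)}.indicator 1 (x, t) := by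
    intro x
    split_ifs with hx
    · have hx1 : 1 ≤ ‖x‖ / ξ := (one_le_div hξ).2 hx.le
      have hρ : (‖x‖ / ξ) ^ (-α) ≤ (1 : ℝ) :=
        Real.rpow_le_one_of_one_le_of_nonpos hx1 (by linarith)
      have hρ0 : 0 ≤ (‖x‖ / ξ) ^ (-α) := by positivity
      rw [← lintegral_Ioo_mul_exp_neg hw hρ0, ← Set.inter_eq_self_of_subset_left
        (Ioo_subset_Ioo_right hρ : Ioo (0 : ℝ) _ ⊆ Ioo 0 1), ← Measure.restrict_restrict measurableSet_Ioo,
        ← lintegral_indicator measurableSet_Ioo]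
      refine setLIntegral_congr_fun measurableSet_Ioo fun t ht => ?_
      simp only [indicator, mem_Ioo, mem_ofPred_eq, hx, true_and, ht.1, Pi.one_apply]
      split_ifs <;> simp
    · simp [indicator, hx]
  have hms : MeasurableSet {p : Plane × ℝ | ξ < ‖p.1‖ ∧ p.2 < (‖p.1‖ / ξ) ^ (-α)} :=
    MeasurableSet.inter (s₁ := {p : Plane × ℝ | ξ < ‖p.1‖})
      (s₂ := {p : Plane × ℝ | p.2 < (‖p.1‖ / ξ) ^ (-α)})
      (measurableSet_lt (by fun_prop) (by fun_prop)) (measurableSet_lt (by fun_prop) (by fun_prop))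
  simp_rw [h1]
  rw [lintegral_lintegral_swap, excess, ← lintegral_const_mul' _ _ ENNReal.ofReal_ne_top]
  · refine setLIntegral_congr_fun measurableSet_Ioo fun t ht => ?_
    rw [lintegral_const_mul' _ _ ENNReal.ofReal_ne_top, ENNReal.ofReal_mul (q := t ^ (-(2 / α)) - 1)
      (mul_nonneg hw (Real.exp_pos _).le), mul_left_comm, ← volume_annulus hα hξ ht]
    have hmt : MeasurableSet {x : Plane | ξ < ‖x‖ ∧ t < (‖x‖ / ξ) ^ (-α)} :=
      MeasurableSet.inter (s₁ := {x : Plane | ξ < ‖x‖}) (s₂ := {x : Plane | t < (‖x‖ / ξ) ^ (-α)})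
        (measurableSet_lt (by fun_prop) (by fun_prop)) (measurableSet_lt (by fun_prop) (by fun_prop))
    have hind : ∀ x : Plane, {p : Plane × ℝ | ξ < ‖p.1‖ ∧ p.2 < (‖p.1‖ / ξ) ^ (-α)}.indicator
        (1 : Plane × ℝ → ℝ≥0∞) (x, t) =
        {x : Plane | ξ < ‖x‖ ∧ t < (‖x‖ / ξ) ^ (-α)}.indicator 1 x := fun x => by
      simp [indicator]
    simp_rw [hind]
    rw [lintegral_indicator_one hmt]
  · refine Measurable.aemeasurable ?_
    exact Measurable.mul (by fun_prop) (measurable_one.indicator hms)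

/-- On `t < 1 / z` one has `t ^ (-2 / α) ≥ z ^ (2 / α)`, and the density `z x exp (-z x t)` has mass
`1 - exp (-x)` there. -/
lemma le_excess_mul (hα : 2 < α) {z x : ℝ} (hz : 1 ≤ z) (hx : 0 ≤ x) :
    ENNReal.ofReal (z ^ (2 / α) - 1) * ENNReal.ofReal (1 - Real.exp (-x)) ≤ excess α (z * x) := by
  have hz0 : 0 < z := by linarith
  have h := lintegral_Ioo_mul_exp_neg (w := z * x) (b := 1 / z) (by positivity) (by positivity)
  rw [show z * x * (1 / z) = x by field_simp] at h
  rw [← h, ← lintegral_const_mul' _ _ ENNReal.ofReal_ne_top]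
  refine (setLIntegral_mono' measurableSet_Ioo fun t ht => ?_).trans
    (lintegral_mono_set (Ioo_subset_Ioo_right (by rw [div_le_one hz0]; exact hz)))
  have hle : z ^ (2 / α) ≤ t ^ (-(2 / α)) := by
    rw [Real.rpow_neg ht.1.le, ← Real.inv_rpow ht.1.le]
    have : z ≤ t⁻¹ := by
      rw [le_inv_comm₀ hz0 ht.1, inv_eq_one_div]; exact ht.2.le
    exact Real.rpow_le_rpow hz0.le this (by positivity)
  have h1 : 1 ≤ z ^ (2 / α) := Real.one_le_rpow hz (by positivity)
  rw [← ENNReal.ofReal_mul (by linarith)]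
  refine ENNReal.ofReal_le_ofReal ?_
  rw [mul_comm]
  exact mul_le_mul_of_nonneg_left (by linarith) (by have := ht.1; positivity)

end ClosedForm

/-! ### Transforms of a gain law, the identity for `Z`, and integrability of the closed forms. -/

section GainLaw

section Gain

variable {ν : Measure ℝ} {α : ℝ}

lemma IsGainLaw.norm_exp_neg_le_one (hν : IsGainLaw ν) {s : ℝ} (hs : 0 ≤ s) :
    ∀ᵐ x ∂ν, ‖Real.exp (-(s * x))‖ ≤ 1 := by
  filter_upwards [hν.nonneg] with x hx
  rw [Real.norm_of_nonneg (Real.exp_pos _).le]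
  simpa using mul_nonneg hs hx

lemma IsGainLaw.integrable_exp_neg (hν : IsGainLaw ν) {s : ℝ} (hs : 0 ≤ s) :
    Integrable (fun x => Real.exp (-(s * x))) ν := by
  have := hν.isProbability
  exact Integrable.of_bound (by fun_prop) 1 (hν.norm_exp_neg_le_one hs)

lemma gainMGF_nonneg (ν : Measure ℝ) (s : ℝ) : 0 ≤ gainMGF ν s :=
  integral_nonneg fun _ => (Real.exp_pos _).le

lemma IsGainLaw.one_sub_gainMGF (hν : IsGainLaw ν) {s : ℝ} (hs : 0 ≤ s) :
    1 - gainMGF ν s = ∫ x, (1 - Real.exp (-(s * x))) ∂ν := by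
  have := hν.isProbability
  rw [integral_sub (integrable_const _) (hν.integrable_exp_neg hs), gainMGF]
  simp

lemma IsGainLaw.gainMGF_le_one (hν : IsGainLaw ν) {s : ℝ} (hs : 0 ≤ s) : gainMGF ν s ≤ 1 := by
  rw [← sub_nonneg, hν.one_sub_gainMGF hs]
  refine integral_nonneg_of_ae ?_
  filter_upwards [hν.nonneg] with x hx
  simpa using mul_nonneg hs hx

lemma IsGainLaw.one_sub_gainMGF_le (hν : IsGainLaw ν) {s : ℝ} (hs : 0 ≤ s) :
    1 - gainMGF ν s ≤ s := by
  have := hν.isProbability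
  rw [hν.one_sub_gainMGF hs]
  calc ∫ x, (1 - Real.exp (-(s * x))) ∂ν ≤ ∫ x, s * x ∂ν := by
        refine integral_mono ((integrable_const _).sub (hν.integrable_exp_neg hs))
          (hν.integrable.const_mul s) fun x => ?_
        have := Real.add_one_le_exp (-(s * x))
        simp only
        linarith
    _ = s := by rw [integral_const_mul, hν.mean_one, mul_one]

/-- Equality would force the gain to vanish almost surely, against mean one. This gives the positive
constant in the growth bound for `Z`. -/
lemma IsGainLaw.gainMGF_one_lt_one (hν : IsGainLaw ν) : gainMGF ν 1 < 1 := by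
  have := hν.isProbability
  refine lt_of_le_of_ne (hν.gainMGF_le_one zero_le_one) fun h => ?_
  have h0 : ∫ x, (1 - Real.exp (-(1 * x))) ∂ν = 0 := by
    rw [← hν.one_sub_gainMGF zero_le_one, h, sub_self]
  rw [integral_eq_zero_iff_of_nonneg_ae] at h0
  · have hz : (fun x : ℝ => x) =ᵐ[ν] fun _ => 0 := by
      filter_upwards [h0] with x hx
      have : Real.exp (-(1 * x)) = 1 := by simp only [Pi.zero_apply] at hx; linarith
      simpa using this
    have := hν.mean_one
    rw [integral_congr_ae hz] at this
    simp at this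
  · filter_upwards [hν.nonneg] with x hx
    simpa using hx
  · exact (integrable_const _).sub (hν.integrable_exp_neg zero_le_one)

lemma IsGainLaw.ofReal_one_sub_gainMGF (hν : IsGainLaw ν) {s : ℝ} (hs : 0 ≤ s) :
    ENNReal.ofReal (1 - gainMGF ν s) = ∫⁻ x, ENNReal.ofReal (1 - Real.exp (-(s * x))) ∂ν := by
  have := hν.isProbability
  rw [hν.one_sub_gainMGF hs, ofReal_integral_eq_lintegral_ofReal
    (by simpa using! (integrable_const (1 : ℝ)).sub (hν.integrable_exp_neg hs))]
  filter_upwards [hν.nonneg] with x hx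
  simpa using mul_nonneg hs hx

lemma IsGainLaw.measurable_gainMGF (hν : IsGainLaw ν) : Measurable (gainMGF ν) := by
  have := hν.isProbability
  have h : StronglyMeasurable fun p : ℝ × ℝ => Real.exp (-(p.1 * p.2)) :=
    Continuous.stronglyMeasurable (by fun_prop)
  exact h.integral_prod_right'.measurable

/-- The expectation of `excess α (z * G)` for a gain `G` with law `ν`. -/
noncomputable def gainExcess (α : ℝ) (ν : Measure ℝ) (z : ℝ) : ℝ≥0∞ := ∫⁻ x, excess α (z * x) ∂ν

lemma IsGainLaw.measurable_gainExcess (hν : IsGainLaw ν) : Measurable (gainExcess α ν) := by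
  have := hν.isProbability
  exact Measurable.lintegral_prod_right' (f := fun p : ℝ × ℝ => excess α (p.1 * p.2))
    ((measurable_excess α).comp (by fun_prop))

lemma one_sub_two_div_pos (hα : 2 < α) : 0 < 1 - 2 / α := by
  rw [sub_pos, div_lt_one (by linarith)]; exact hα

/-- No higher moments are assumed: `u ^ n / n! ≤ exp u` bounds the integrand by `n! / y ^ n`. -/
lemma IsGainLaw.integrable_pow_mul_exp_neg (hν : IsGainLaw ν) {y : ℝ} (hy : 0 < y) (n : ℕ) :
    Integrable (fun x => x ^ n * Real.exp (-(y * x))) ν := by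
  have := hν.isProbability
  refine Integrable.of_bound (by fun_prop) (n.factorial / y ^ n) ?_
  filter_upwards [hν.nonneg] with x hx
  rw [Real.norm_of_nonneg (by positivity), le_div_iff₀ (by positivity), Real.exp_neg]
  have := Real.pow_div_factorial_le_exp (y * x) (by positivity) n
  rw [div_le_iff₀ (by positivity), mul_pow] at this
  field_simp
  linarith

lemma IsGainLaw.seriesTerm_nonneg (hν : IsGainLaw ν) (hα : 2 < α) {y : ℝ} (hy : 0 ≤ y) (k : ℕ) :
    0 ≤ seriesTerm α ν y k := by
  have hG : 0 < Real.Gamma (2 - 2 / α + k) := Real.Gamma_pos_of_pos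
    (by have := one_sub_two_div_pos hα; have : (0 : ℝ) ≤ k := by positivity
        linarith)
  have : 0 ≤ gainMoment ν k y := by
    refine integral_nonneg_of_ae ?_
    filter_upwards [hν.nonneg] with x hx
    simp only [Pi.zero_apply]
    positivity
  unfold seriesTerm
  positivity

/-- The average of `excess_add` and of the incomplete gamma series. Working in `[0, ∞]` lets
summability be deduced from this identity. -/
lemma IsGainLaw.tsum_ofReal_seriesTerm (hν : IsGainLaw ν) (hα : 2 < α) {y : ℝ} (hy : 0 < y) :
    ∑' k, ENNReal.ofReal (Real.Gamma (1 - 2 / α) * seriesTerm α ν y k) =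
      gainExcess α ν y + ENNReal.ofReal (1 - gainMGF ν y) := by
  have ha := one_sub_two_div_pos hα
  have hG := Real.Gamma_pos_of_pos ha
  rw [gainExcess, hν.ofReal_one_sub_gainMGF hy.le,
    ← lintegral_add_left (f := fun x => excess α (y * x))
    ((measurable_excess α).comp (measurable_const_mul y))]
  have h : ∀ᵐ x ∂ν, excess α (y * x) + ENNReal.ofReal (1 - Real.exp (-(y * x))) =
      ∑' k : ℕ, ENNReal.ofReal (Real.Gamma (1 - 2 / α) * ((y * x) ^ (k + 1) * Real.exp (-(y * x)) *
        (Real.Gamma (1 - 2 / α + 1 + k))⁻¹)) := by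
    filter_upwards [hν.nonneg] with x hx
    rw [excess_add hα (by positivity), lintegral_mul_exp_neg_mul_rpow ha (by positivity)]
  rw [lintegral_congr_ae h, lintegral_tsum fun k => by fun_prop]
  refine tsum_congr fun k => ?_
  have hGk : 0 < Real.Gamma (1 - 2 / α + 1 + k) := Real.Gamma_pos_of_pos (by positivity)
  have heq : ∀ x : ℝ, Real.Gamma (1 - 2 / α) * ((y * x) ^ (k + 1) * Real.exp (-(y * x)) *
      (Real.Gamma (1 - 2 / α + 1 + k))⁻¹) = Real.Gamma (1 - 2 / α) * (y ^ (k + 1) *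
        (Real.Gamma (1 - 2 / α + 1 + k))⁻¹) * (x ^ (k + 1) * Real.exp (-(y * x))) := fun x => by
    rw [mul_pow]; ring
  simp_rw [heq]
  rw [← ofReal_integral_eq_lintegral_ofReal ((hν.integrable_pow_mul_exp_neg hy _).const_mul _),
    integral_const_mul]
  · congr 1
    rw [seriesTerm, gainMoment, show 2 - 2 / α + (k : ℝ) = 1 - 2 / α + 1 + k by ring]
    ring
  · filter_upwards [hν.nonneg] with x hx
    simp only [Pi.zero_apply]
    positivity

lemma IsGainLaw.gainExcess_ne_top (hν : IsGainLaw ν) (hα : 2 < α) {y : ℝ} (hy : 0 ≤ y) :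
    gainExcess α ν y ≠ ∞ := by
  have ha := one_sub_two_div_pos hα
  have h : ∀ᵐ x ∂ν, excess α (y * x) ≤ ENNReal.ofReal (y * x) *
      ENNReal.ofReal (Real.Gamma (1 - 2 / α) / Real.Gamma (1 - 2 / α + 1)) := by
    filter_upwards [hν.nonneg] with x hx
    refine le_trans ?_ (lintegral_mul_exp_neg_mul_rpow_le ha (by positivity))
    rw [← excess_add hα (by positivity)]
    exact le_self_add
  refine ((lintegral_mono_ae h).trans_lt ?_).ne
  rw [lintegral_mul_const _ (by fun_prop)]
  refine ENNReal.mul_lt_top ?_ ENNReal.ofReal_lt_top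
  exact (hν.integrable.const_mul y).lintegral_lt_top

lemma IsGainLaw.summable_seriesTerm (hν : IsGainLaw ν) (hα : 2 < α) {y : ℝ} (hy : 0 < y) :
    Summable (seriesTerm α ν y) := by
  have hG := Real.Gamma_pos_of_pos (one_sub_two_div_pos hα)
  have h := ENNReal.summable_toReal (f := fun k =>
    ENNReal.ofReal (Real.Gamma (1 - 2 / α) * seriesTerm α ν y k)) (by
      rw [hν.tsum_ofReal_seriesTerm hα hy]
      exact ENNReal.add_ne_top.2 ⟨hν.gainExcess_ne_top hα hy.le, ENNReal.ofReal_ne_top⟩)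
  simp_rw [fun k => ENNReal.toReal_ofReal
    (mul_nonneg hG.le (hν.seriesTerm_nonneg hα hy.le k))] at h
  exact (summable_mul_left_iff hG.ne').1 h

/-- The term `1 - M_I` carried by the series cancels the `M_I` in `Z`. -/
lemma IsGainLaw.Z_eq (hν : IsGainLaw ν) (hα : 2 < α) {y : ℝ} (hy : 0 < y) :
    Z α ν y = 1 + (gainExcess α ν y).toReal := by
  have hG := Real.Gamma_pos_of_pos (one_sub_two_div_pos hα)
  have h := congrArg ENNReal.toReal (hν.tsum_ofReal_seriesTerm hα hy)
  have hM := hν.gainMGF_le_one hy.le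
  rw [← ENNReal.ofReal_tsum_of_nonneg
    (fun k => mul_nonneg hG.le (hν.seriesTerm_nonneg hα hy.le k))
    ((hν.summable_seriesTerm hα hy).mul_left _), tsum_mul_left, ENNReal.toReal_ofReal
    (mul_nonneg hG.le (tsum_nonneg fun k => hν.seriesTerm_nonneg hα hy.le k)),
    ENNReal.toReal_add (hν.gainExcess_ne_top hα hy.le) ENNReal.ofReal_ne_top,
    ENNReal.toReal_ofReal (by linarith)] at h
  rw [Z, T, h]
  ring

lemma IsGainLaw.one_le_Z (hν : IsGainLaw ν) (hα : 2 < α) {y : ℝ} (hy : 0 < y) : 1 ≤ Z α ν y := by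
  rw [hν.Z_eq hα hy]
  linarith [ENNReal.toReal_nonneg (a := gainExcess α ν y)]

lemma IsGainLaw.le_gainExcess (hν : IsGainLaw ν) (hα : 2 < α) {z : ℝ} (hz : 1 ≤ z) :
    ENNReal.ofReal (z ^ (2 / α) - 1) * ENNReal.ofReal (1 - gainMGF ν 1) ≤ gainExcess α ν z := by
  rw [hν.ofReal_one_sub_gainMGF zero_le_one, ← lintegral_const_mul' _ _ ENNReal.ofReal_ne_top]
  refine lintegral_mono_ae ?_
  filter_upwards [hν.nonneg] with x hx
  rw [one_mul]
  exact le_excess_mul hα hz hx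

/-- For `z ≥ 1` the loss from `z ^ (2 / α) - 1` is absorbed by the summand one of `Z`; for `z ≤ 1`
the bound `Z ≥ 1` suffices. -/
lemma IsGainLaw.rpow_le_Z (hν : IsGainLaw ν) (hα : 2 < α) {z : ℝ} (hz : 0 < z) :
    (1 - gainMGF ν 1) * z ^ (2 / α) ≤ Z α ν z := by
  have hc := hν.gainMGF_one_lt_one
  have hc1 := gainMGF_nonneg ν 1
  rcases le_total 1 z with h | h
  · have h1 : 1 ≤ z ^ (2 / α) := Real.one_le_rpow h (by positivity)
    have := ENNReal.toReal_mono (hν.gainExcess_ne_top hα hz.le) (hν.le_gainExcess hα h)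
    rw [ENNReal.toReal_mul, ENNReal.toReal_ofReal (by linarith),
      ENNReal.toReal_ofReal (by linarith)] at this
    rw [hν.Z_eq hα hz]
    linarith
  · have h1 : z ^ (2 / α) ≤ 1 := Real.rpow_le_one hz.le h (by positivity)
    have h2 : 0 ≤ z ^ (2 / α) := by positivity
    have := hν.one_le_Z hα hz
    nlinarith

lemma IsGainLaw.tendsto_gainExcess (hν : IsGainLaw ν) (hα : 2 < α) :
    Tendsto (gainExcess α ν) atTop (𝓝 ∞) := by
  have hc := hν.gainMGF_one_lt_one
  have h1 : Tendsto (fun z : ℝ => ENNReal.ofReal (z ^ (2 / α) - 1) *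
      ENNReal.ofReal (1 - gainMGF ν 1)) atTop (𝓝 (∞ * ENNReal.ofReal (1 - gainMGF ν 1))) := by
    refine ENNReal.Tendsto.mul_const (ENNReal.tendsto_ofReal_atTop.comp ?_) (Or.inl (by simp))
    exact tendsto_atTop_add_const_right _ _ (tendsto_rpow_atTop (by positivity))
  rw [ENNReal.top_mul (by simpa using hc)] at h1
  refine tendsto_nhds_top_mono h1 ?_
  filter_upwards [eventually_ge_atTop 1] with z hz using hν.le_gainExcess hα hz

lemma IsGainLaw.aemeasurable_Z (hν : IsGainLaw ν) (hα : 2 < α) :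
    AEMeasurable (Z α ν) (volume.restrict (Ioi 0)) := by
  refine (hν.measurable_gainExcess (α := α)).ennreal_toReal.const_add 1 |>.aemeasurable.congr ?_
  filter_upwards [ae_restrict_mem measurableSet_Ioi] with z hz
  exact (hν.Z_eq hα hz).symm

lemma integrableOn_Ioi_of_le_rpow {f : ℝ → ℝ} {C p : ℝ} (hp : p < -1)
    (hf : AEMeasurable f (volume.restrict (Ioi 0))) (h1 : ∀ z ∈ Ioi (0 : ℝ), ‖f z‖ ≤ 1)
    (h2 : ∀ z ∈ Ioi (0 : ℝ), ‖f z‖ ≤ C * z ^ p) : IntegrableOn f (Ioi 0) := by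
  rw [← Ioc_union_Ioi_eq_Ioi zero_le_one]
  refine IntegrableOn.union ?_ ?_
  · refine Integrable.of_bound (hf.mono_measure
      (Measure.restrict_mono Ioc_subset_Ioi_self le_rfl)).aestronglyMeasurable 1 ?_
    filter_upwards [ae_restrict_mem measurableSet_Ioc] with z hz using h1 z hz.1
  · refine Integrable.mono' ((integrableOn_Ioi_rpow_of_lt hp zero_lt_one).const_mul C)
      (hf.mono_measure (Measure.restrict_mono
        (Ioi_subset_Ioi zero_le_one) le_rfl)).aestronglyMeasurable ?_
    filter_upwards [ae_restrict_mem measurableSet_Ioi] with z hz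
    exact h2 z (mem_Ioi.2 (zero_lt_one.trans (mem_Ioi.1 hz)))

variable {ν₀ : Measure ℝ}

lemma integrableOn_rateLimit (hν₀ : IsGainLaw ν₀) (hν : IsGainLaw ν) (hα : 2 < α) :
    IntegrableOn (fun z => (1 - gainMGF ν₀ z) / Z α ν z / z) (Ioi 0) := by
  have hc : 0 < 1 - gainMGF ν 1 := by linarith [hν.gainMGF_one_lt_one]
  have hZm := hν.aemeasurable_Z hα
  have hMm := hν₀.measurable_gainMGF
  -- The tail uses `1 - M₀ ≤ 1` and `rpow_le_Z`; near zero `1 - M₀ z ≤ z` cancels the factor `1 /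
  -- z`.
  refine integrableOn_Ioi_of_le_rpow (C := (1 - gainMGF ν 1)⁻¹) (p := -(2 / α) - 1)
    (by have : 0 < 2 / α := by positivity
        linarith) (by fun_prop) (fun z hz => ?_) (fun z hz => ?_)
  all_goals
    have hz : 0 < z := hz
    have hZ := hν.one_le_Z hα hz
    have hM := hν₀.gainMGF_le_one hz.le
    have hM1 := hν₀.one_sub_gainMGF_le hz.le
    have hM0 := gainMGF_nonneg ν₀ z
    have hZ0 : 0 < Z α ν z := by linarith
    rw [Real.norm_of_nonneg (div_nonneg (div_nonneg (by linarith) hZ0.le) hz.le)]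
  · rw [div_le_one hz]
    exact (div_le_self (by linarith) hZ).trans hM1
  · have hr := hν.rpow_le_Z hα hz
    rw [Real.rpow_sub_one hz.ne', Real.rpow_neg hz.le, ← mul_div_assoc]
    gcongr
    rw [← mul_inv, ← one_div]
    gcongr
    linarith

lemma integrableOn_correction (hν₀ : IsGainLaw ν₀) (hν : IsGainLaw ν) (hα : 2 < α) :
    IntegrableOn (fun z => (1 - gainMGF ν₀ z) / Z α ν z ^ (1 + α / 2)) (Ioi 0) := by
  have hc : 0 < 1 - gainMGF ν 1 := by linarith [hν.gainMGF_one_lt_one]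
  have hZm := hν.aemeasurable_Z hα
  have hMm := hν₀.measurable_gainMGF
  have hα0 : 0 < α := by linarith
  -- Raising `rpow_le_Z` to the power `1 + α / 2` gives decay of order `2 / α + 1 > 1`.
  refine integrableOn_Ioi_of_le_rpow (C := ((1 - gainMGF ν 1) ^ (1 + α / 2))⁻¹)
    (p := -(2 / α * (1 + α / 2)))
    (by have : 0 < 2 / α := by positivity
        have : 2 / α * (1 + α / 2) = 2 / α + 1 := by field_simp
        linarith) (by fun_prop) (fun z hz => ?_) (fun z hz => ?_)
  all_goals
    have hz : 0 < z := hz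
    have hZ := hν.one_le_Z hα hz
    have hM := hν₀.gainMGF_le_one hz.le
    have hM0 := gainMGF_nonneg ν₀ z
    have hZ0 : 0 < Z α ν z := by linarith
    rw [Real.norm_of_nonneg (div_nonneg (by linarith) (by positivity))]
  · exact (div_le_one (by positivity)).2
      ((by linarith : 1 - gainMGF ν₀ z ≤ 1).trans (Real.one_le_rpow hZ (by positivity)))
  · have hr := hν.rpow_le_Z hα hz
    rw [Real.rpow_neg hz.le, Real.rpow_mul hz.le, ← mul_inv,
      ← Real.mul_rpow hc.le (by positivity), ← one_div]
    gcongr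
    linarith

end Gain

end GainLaw

/-! ### The conditional rate as an integral over the transform variable. -/

section ConditionalRate

variable {Ω : Type*} {α dens : ℝ} {ν₀ νI : Measure ℝ} {X : ℕ → Ω → Plane} {g : ℕ → Ω → ℝ} {g₀ : Ω → ℝ}

/-- The interference as a function of the locations and gains, in units of the received power
per unit gain at distance `ξ`. -/
noncomputable def relInterference (α ξ : ℝ) (p : (ℕ → Plane) × (ℕ → ℝ)) : ℝ≥0∞ :=
  ∑' n, if ξ < ‖p.1 n‖ then ENNReal.ofReal (p.2 n * (‖p.1 n‖ / ξ) ^ (-α)) else 0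

lemma measurable_relInterference (α ξ : ℝ) : Measurable (relInterference α ξ) := by
  unfold relInterference
  refine Measurable.tsum fun n => Measurable.ite
    (measurableSet_lt (by fun_prop) (by fun_prop)) (by fun_prop) (by fun_prop)

lemma aggInterference_mul {P ξ : ℝ} (hP : 0 < P) (hξ : 0 < ξ) (ω : Ω) :
    aggInterference α P ξ X g ω * ENNReal.ofReal (ξ ^ α / P) =
      relInterference α ξ (fun n => X n ω, fun n => g n ω) := by
  rw [aggInterference, ← ENNReal.tsum_mul_right, relInterference]
  refine tsum_congr fun n => ?_
  simp only
  split_ifs with h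
  · rw [← ENNReal.ofReal_mul' (by positivity)]
    congr 1
    rw [Real.div_rpow (norm_nonneg _) hξ.le, Real.rpow_neg hξ.le]
    field_simp
  · simp

/-- Both sides of the fraction are multiplied by `ξ ^ α / P`, so the power enters only through
`noise / P`. -/
lemma sinr_eq {P noise ξ : ℝ} (hP : 0 < P) (hn : 0 ≤ noise) (hξ : 0 < ξ) (ω : Ω) :
    sinr α P noise ξ X g g₀ ω = (ENNReal.ofReal (g₀ ω) / (ENNReal.ofReal (noise / P * ξ ^ α) +
      relInterference α ξ (fun n => X n ω, fun n => g n ω))).toReal := by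
  have hc : 0 < ξ ^ α / P := by positivity
  rw [sinr, ← ENNReal.mul_div_mul_right _ _ (c := ENNReal.ofReal (ξ ^ α / P)) (by simpa using hc)
    ENNReal.ofReal_ne_top, add_mul, aggInterference_mul hP hξ, ← ENNReal.ofReal_mul hn,
    ← ENNReal.ofReal_mul' hc.le, Real.rpow_neg hξ.le]
  congr 3
  · field_simp
  · congr 1; field_simp

variable [MeasurableSpace Ω] {μ : Measure Ω} [IsProbabilityMeasure μ]

/-- The Laplace transform of the interference from beyond the distance `ξ`. -/
lemma IsSingleTierNetwork.lintegral_expNeg_relInterference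
    (hnet : IsSingleTierNetwork μ dens ν₀ νI X g g₀) (hνI : IsGainLaw νI) (hα : 2 < α)
    (hd : 0 ≤ dens) {ξ z : ℝ} (hξ : 0 < ξ) (hz : 0 ≤ z) :
    ∫⁻ ω, expNeg (ENNReal.ofReal z *
        relInterference α ξ (fun n => X n ω, fun n => g n ω)) ∂μ =
      expNeg (ENNReal.ofReal (Real.pi * dens * ξ ^ 2) * gainExcess α νI z) := by
  have := hνI.isProbability
  let f : Plane → ℝ → ℝ≥0∞ := fun x y =>
    if ξ < ‖x‖ then ENNReal.ofReal (z * y * (‖x‖ / ξ) ^ (-α)) else 0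
  have hf : Measurable (Function.uncurry f) :=
    Measurable.ite (measurableSet_lt (by fun_prop) (by fun_prop)) (by fun_prop) (by fun_prop)
  let G : Plane → ℝ → ℝ≥0∞ := fun x y =>
    if ξ < ‖x‖ then ENNReal.ofReal (1 - Real.exp (-(z * y * (‖x‖ / ξ) ^ (-α)))) else 0
  have hG : Measurable (Function.uncurry G) :=
    Measurable.ite (measurableSet_lt (by fun_prop) (by fun_prop)) (by fun_prop) (by fun_prop)
  have hsum : ∀ ω, ENNReal.ofReal z * relInterference α ξ (fun n => X n ω, fun n => g n ω) =
      ∑' n, f (X n ω) (g n ω) := by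
    intro ω
    rw [relInterference, ← ENNReal.tsum_mul_left]
    refine tsum_congr fun n => ?_
    simp only [f]
    split_ifs
    · rw [← ENNReal.ofReal_mul hz, mul_assoc]
    · simp
  simp_rw [hsum]
  rw [hnet.ppp.lintegral_expNeg_tsum_marked hd hnet.gain_measurable hnet.gain_law hnet.gain_indep
    hnet.indep_locations_gains hf]
  have hsub : ∀ x, 1 - ∫⁻ y, expNeg (f x y) ∂νI = ∫⁻ y, G x y ∂νI := by
    intro x
    have hfx : Measurable fun y => expNeg (f x y) :=
      measurable_expNeg.comp hf.of_uncurry_left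
    have h1 : ∫⁻ y, expNeg (f x y) ∂νI ≠ ∞ :=
      ((lintegral_mono fun y => expNeg_le_one _).trans_lt (by simp)).ne
    have h2 := lintegral_sub hfx h1 (ae_of_all _ fun y => expNeg_le_one (f x y))
      (f := fun _ => 1)
    rw [lintegral_one, measure_univ] at h2
    rw [← h2]
    refine lintegral_congr_ae ?_
    filter_upwards [hνI.nonneg] with y hy
    simp only [f, G]
    split_ifs
    · rw [expNeg_ofReal (by positivity), ENNReal.ofReal_sub _ (Real.exp_pos _).le,
        ENNReal.ofReal_one]
    · simp
  simp_rw [hsub]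
  -- With the gain `y` held fixed, the plane integral is the layer-cake one with `w = z * y`.
  rw [lintegral_lintegral_swap hG.aemeasurable]
  have hin : ∀ᵐ y ∂νI, ∫⁻ x, G x y = ENNReal.ofReal (Real.pi * ξ ^ 2) * excess α (z * y) := by
    filter_upwards [hνI.nonneg] with y hy
    exact lintegral_one_sub_exp_neg_norm hα hξ (by positivity)
  rw [lintegral_congr_ae hin, lintegral_const_mul' _ _ ENNReal.ofReal_ne_top, ← mul_assoc,
    ← ENNReal.ofReal_mul hd, gainExcess]
  ring_nf

/-- Without noise, vanishing interference would give an infinite quotient, which `toReal` sends to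
zero. Its probability is at most `E exp (-z I)` for every `z ≥ 0`, and this tends to zero because
`gainExcess` tends to infinity. -/
lemma IsSingleTierNetwork.relInterference_ne_zero
    (hnet : IsSingleTierNetwork μ dens ν₀ νI X g g₀) (hνI : IsGainLaw νI) (hα : 2 < α)
    (hd : 0 < dens) {ξ : ℝ} (hξ : 0 < ξ) :
    ∀ᵐ ω ∂μ, relInterference α ξ (fun n => X n ω, fun n => g n ω) ≠ 0 := by
  have hXm : Measurable fun ω => (fun n => X n ω, fun n => g n ω) :=
    (measurable_pi_lambda _ hnet.ppp.measurable).prodMk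
      (measurable_pi_lambda _ hnet.gain_measurable)
  have hms : MeasurableSet {ω | relInterference α ξ (fun n => X n ω, fun n => g n ω) = 0} :=
    ((measurable_relInterference α ξ).comp hXm) (measurableSet_singleton 0)
  have hle : ∀ z : ℝ, 0 ≤ z →
      μ {ω | relInterference α ξ (fun n => X n ω, fun n => g n ω) = 0} ≤
        expNeg (ENNReal.ofReal (Real.pi * dens * ξ ^ 2) * gainExcess α νI z) := by
    intro z hz
    rw [← hnet.lintegral_expNeg_relInterference hνI hα hd.le hξ hz, ← lintegral_indicator_one hms]
    refine lintegral_mono fun ω => ?_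
    simp only [indicator, mem_ofPred_eq, Pi.one_apply]
    split_ifs with h
    · simp [h]
    · exact zero_le
  have hlim : Tendsto (fun z => expNeg (ENNReal.ofReal (Real.pi * dens * ξ ^ 2) *
      gainExcess α νI z)) atTop (𝓝 0) := by
    have hk : ENNReal.ofReal (Real.pi * dens * ξ ^ 2) ≠ 0 := by
      have : 0 < Real.pi * dens * ξ ^ 2 := by positivity
      simpa using this
    have h := (continuous_expNeg.tendsto _).comp
      (ENNReal.Tendsto.const_mul (a := ENNReal.ofReal (Real.pi * dens * ξ ^ 2))
        (hνI.tendsto_gainExcess hα) (Or.inr ENNReal.ofReal_ne_top))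
    rw [ENNReal.mul_top hk, expNeg_top] at h
    exact h
  have h0 : μ {ω | relInterference α ξ (fun n => X n ω, fun n => g n ω) = 0} = 0 := by
    refine le_antisymm (ge_of_tendsto hlim ?_) zero_le
    filter_upwards [eventually_ge_atTop 0] with z hz using hle z hz
  rw [ae_iff]
  simpa using h0

/-- The integrand of the integral representation of the conditional rate; `η` is the
inverse of the SNR. -/
noncomputable def rateIntegrand (α dens : ℝ) (ν₀ νI : Measure ℝ) (η ξ z : ℝ) : ℝ :=
  (1 - gainMGF ν₀ z) / z * (Real.exp (-(η * ξ ^ α * z)) *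
    Real.exp (-(Real.pi * dens * ξ ^ 2 * (Z α νI z - 1))))

/-- After the logarithm representation and Tonelli, independence of the serving gain splits the
expectation into `1 - M₀` and the transform of noise plus interference. -/
lemma IsSingleTierNetwork.lintegral_log_one_add_sinr
    (hnet : IsSingleTierNetwork μ dens ν₀ νI X g g₀) (hν₀ : IsGainLaw ν₀) (hνI : IsGainLaw νI)
    (hα : 2 < α) (hd : 0 < dens) {P noise ξ : ℝ} (hP : 0 < P) (hn : 0 ≤ noise) (hξ : 0 < ξ) :
    ∫⁻ ω, ENNReal.ofReal (Real.log (1 + sinr α P noise ξ X g g₀ ω)) ∂μ =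
      ∫⁻ z in Ioi 0, ENNReal.ofReal (rateIntegrand α dens ν₀ νI (noise / P) ξ z) := by
  have hXm : Measurable fun ω => ((fun n => X n ω), (fun n => g n ω)) :=
    (measurable_pi_lambda _ hnet.ppp.measurable).prodMk
      (measurable_pi_lambda _ hnet.gain_measurable)
  have hRm := (measurable_relInterference α ξ).comp hXm
  have hgm := hnet.serving_measurable
  let c := noise / P * ξ ^ α
  have hc : 0 ≤ c := by positivity
  let Y : Ω → ℝ≥0∞ := fun ω =>
    ENNReal.ofReal c + relInterference α ξ (fun n => X n ω, fun n => g n ω)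
  have hYm : Measurable Y := measurable_const.add hRm
  have hg0 : ∀ᵐ ω ∂μ, 0 ≤ g₀ ω :=
    (hnet.serving_law.ae_iff (p := fun x => 0 ≤ x)
      (measurableSet_Ici.mem)).2 hν₀.nonneg
  have h1 : ∀ᵐ ω ∂μ, ENNReal.ofReal (Real.log (1 + sinr α P noise ξ X g g₀ ω)) =
      ∫⁻ z in Ioi 0, ENNReal.ofReal ((1 - Real.exp (-(z * g₀ ω))) / z) *
        expNeg (ENNReal.ofReal z * Y ω) := by
    filter_upwards [hnet.relInterference_ne_zero hνI hα hd hξ, hg0] with ω h h'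
    rw [lintegral_one_sub_exp_div_mul_expNeg h' (by simp [Y, h]), sinr_eq hP hn hξ]
  rw [lintegral_congr_ae h1, lintegral_lintegral_swap]
  · refine setLIntegral_congr_fun measurableSet_Ioi fun z hz => ?_
    have hz : 0 < z := hz
    have hZ := hνI.Z_eq hα hz
    have hind := hnet.indep_serving.comp
      (φ := fun x => ENNReal.ofReal ((1 - Real.exp (-(z * x))) / z))
      (ψ := fun p => expNeg (ENNReal.ofReal z * (ENNReal.ofReal c + relInterference α ξ p)))
      (by fun_prop) (measurable_expNeg.comp
        ((measurable_const.add (measurable_relInterference α ξ)).const_mul _))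
    have hprod := lintegral_mul_eq_lintegral_mul_lintegral_of_indepFun
      (f := fun ω => ENNReal.ofReal ((1 - Real.exp (-(z * g₀ ω))) / z))
      (g := fun ω => expNeg (ENNReal.ofReal z * Y ω))
      (by fun_prop) (measurable_expNeg.comp (hYm.const_mul _)) hind
    refine hprod.trans ?_
    have hA : ∫⁻ ω, ENNReal.ofReal ((1 - Real.exp (-(z * g₀ ω))) / z) ∂μ =
        ENNReal.ofReal ((1 - gainMGF ν₀ z) / z) := by
      have := hnet.serving_law.lintegral_comp
        (f := fun x => ENNReal.ofReal ((1 - Real.exp (-(z * x))) / z)) (by fun_prop)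
      rw [this]
      simp_rw [ENNReal.ofReal_div_of_pos hz, div_eq_mul_inv]
      rw [lintegral_mul_const _ (by fun_prop), hν₀.ofReal_one_sub_gainMGF hz.le]
    have hB : ∫⁻ ω, expNeg (ENNReal.ofReal z * Y ω) ∂μ =
        ENNReal.ofReal (Real.exp (-(noise / P * ξ ^ α * z))) *
        ENNReal.ofReal (Real.exp (-(Real.pi * dens * ξ ^ 2 * (Z α νI z - 1)))) := by
      simp only [Y, mul_add, expNeg_add]
      rw [lintegral_const_mul' _ _ ((expNeg_le_one _).trans_lt (by simp)).ne,
        hnet.lintegral_expNeg_relInterference hνI hα hd.le hξ hz.le, ← ENNReal.ofReal_mul hz.le,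
        expNeg_ofReal (by positivity), hZ, ← ENNReal.ofReal_toReal (hνI.gainExcess_ne_top hα hz.le),
        ← ENNReal.ofReal_mul (by positivity),
        expNeg_ofReal (mul_nonneg (by positivity) ENNReal.toReal_nonneg),
        ENNReal.toReal_ofReal ENNReal.toReal_nonneg]
      congr 2
      · simp only [c]; ring_nf
      · ring_nf
    rw [hA, hB, ← ENNReal.ofReal_mul (Real.exp_pos _).le, ← ENNReal.ofReal_mul
      (div_nonneg (by linarith [hν₀.gainMGF_le_one hz.le]) hz.le), rateIntegrand]
  · refine Measurable.aemeasurable ?_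
    refine Measurable.mul (by fun_prop) (measurable_expNeg.comp ?_)
    exact (by fun_prop : Measurable fun p : Ω × ℝ => ENNReal.ofReal p.2).mul
      (hYm.comp measurable_fst)

end ConditionalRate

/-! ### Averaging over the serving distance, and the bounds in the SNR. -/

section AverageRate

section Closed

variable {α dens : ℝ} {ν₀ νI : Measure ℝ}

lemma aemeasurable_rateIntegrand (hν₀ : IsGainLaw ν₀) (hνI : IsGainLaw νI) (hα : 2 < α) (η : ℝ) :
    AEMeasurable (Function.uncurry fun ξ z => rateIntegrand α dens ν₀ νI η ξ z)
      ((volume.restrict (Ioi 0)).prod (volume.restrict (Ioi 0))) := by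
  have hM := hν₀.measurable_gainMGF
  have hZ : AEMeasurable (fun p : ℝ × ℝ => Z α νI p.2)
      ((volume.restrict (Ioi 0)).prod (volume.restrict (Ioi 0))) := (hνI.aemeasurable_Z hα).comp_snd
  unfold Function.uncurry rateIntegrand
  fun_prop

lemma lintegral_rateIntegrand_lt_top (hν₀ : IsGainLaw ν₀) (hνI : IsGainLaw νI) (hα : 2 < α)
    (hd : 0 < dens) {η ξ : ℝ} (hη : 0 ≤ η) (hξ : 0 < ξ) :
    ∫⁻ z in Ioi 0, ENNReal.ofReal (rateIntegrand α dens ν₀ νI η ξ z) < ∞ := by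
  let k := Real.pi * dens * ξ ^ 2
  have hk : 0 < k := by positivity
  -- This makes `exp (k (Z - 1)) ≥ 1 + k (Z - 1) ≥ m Z`, so the integrand is dominated by a multiple
  -- of that of `rateLimit`.
  let m := min 1 k
  have hm : 0 < m := lt_min one_pos hk
  refine lt_of_le_of_lt (setLIntegral_mono' measurableSet_Ioi fun z hz => ?_)
    ((integrableOn_rateLimit hν₀ hνI hα).const_mul m⁻¹).lintegral_lt_top
  have hz : 0 < z := hz
  refine ENNReal.ofReal_le_ofReal ?_
  have hM := hν₀.gainMGF_le_one hz.le
  have hZ := hνI.one_le_Z hα hz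
  have h1 : Real.exp (-(η * ξ ^ α * z)) ≤ 1 := by
    have : 0 ≤ η * ξ ^ α * z := by positivity
    simpa using this
  have h2 : Real.exp (-(k * (Z α νI z - 1))) ≤ (m * Z α νI z)⁻¹ := by
    rw [Real.exp_neg]
    refine inv_anti₀ (by positivity) ?_
    have h3 := Real.add_one_le_exp (k * (Z α νI z - 1))
    have h4 : m ≤ 1 := min_le_left _ _
    have h5 : m ≤ k := min_le_right _ _
    nlinarith
  have h6 : Real.exp (-(η * ξ ^ α * z)) * Real.exp (-(k * (Z α νI z - 1))) ≤
      1 * (m * Z α νI z)⁻¹ := by gcongr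
  calc rateIntegrand α dens ν₀ νI η ξ z
      ≤ (1 - gainMGF ν₀ z) / z * (1 * (m * Z α νI z)⁻¹) :=
        mul_le_mul_of_nonneg_left h6 (div_nonneg (by linarith) hz.le)
    _ = m⁻¹ * ((1 - gainMGF ν₀ z) / Z α νI z / z) := by field_simp

/-- The integral over the distance of the serving BS, for fixed `b = π dens Z z`. -/
noncomputable def distanceIntegral (α η b z : ℝ) : ℝ≥0∞ :=
  ∫⁻ ξ in Ioi 0, ENNReal.ofReal (ξ * Real.exp (-(b * ξ ^ 2)) * Real.exp (-(η * ξ ^ α * z)))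

lemma distanceIntegral_zero (z : ℝ) {b : ℝ} (hb : 0 < b) :
    distanceIntegral α 0 b z = ENNReal.ofReal (1 / (2 * b)) := by
  have h := lintegral_rpow_mul_exp_neg_mul_sq (q := 1) (by norm_num) hb
  have h2 : b ^ (-(1 + 1) / 2 : ℝ) * (1 / 2) * Real.Gamma ((1 + 1) / 2) = 1 / (2 * b) := by
    norm_num [Real.rpow_neg_one]
  rw [h2] at h
  simpa [distanceIntegral] using h

lemma distanceIntegral_le {η z : ℝ} (hη : 0 ≤ η) (hz : 0 ≤ z) (b : ℝ) :
    distanceIntegral α η b z ≤ distanceIntegral α 0 b z := by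
  refine setLIntegral_mono' measurableSet_Ioi fun ξ hξ => ENNReal.ofReal_le_ofReal ?_
  have hξ : 0 < ξ := hξ
  have : 0 ≤ η * ξ ^ α * z := by positivity
  gcongr

/-- From `1 ≤ exp (-u) + u` with `u = η ξ ^ α z`; the linear term is the Gaussian moment of order `α
+ 1`. -/
lemma distanceIntegral_zero_le {η z b : ℝ} (hα : 2 < α) (hη : 0 ≤ η) (hz : 0 ≤ z) (hb : 0 < b) :
    distanceIntegral α 0 b z ≤ distanceIntegral α η b z + ENNReal.ofReal
      (η * z * (1 / 2 * b ^ (-(1 + α / 2)) * Real.Gamma (1 + α / 2))) := by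
  have h := lintegral_rpow_mul_exp_neg_mul_sq (q := α + 1) (by linarith) hb
  have h2 : b ^ (-(α + 1 + 1) / 2) * (1 / 2) * Real.Gamma ((α + 1 + 1) / 2) =
      1 / 2 * b ^ (-(1 + α / 2)) * Real.Gamma (1 + α / 2) := by
    rw [show -(α + 1 + 1) / 2 = -(1 + α / 2) by ring, show (α + 1 + 1) / 2 = 1 + α / 2 by ring]
    ring
  rw [h2] at h
  rw [ENNReal.ofReal_mul (by positivity), ← h, ← lintegral_const_mul' _ _ ENNReal.ofReal_ne_top,
    distanceIntegral, distanceIntegral, ← lintegral_add_left (by fun_prop)]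
  refine setLIntegral_mono' measurableSet_Ioi fun ξ hξ => ?_
  have hξ : 0 < ξ := hξ
  rw [← ENNReal.ofReal_mul (by positivity), ← ENNReal.ofReal_add (by positivity) (by positivity)]
  refine ENNReal.ofReal_le_ofReal ?_
  have h3 := Real.add_one_le_exp (-(η * ξ ^ α * z))
  have h4 : 0 ≤ ξ * Real.exp (-(b * ξ ^ 2)) := by positivity
  rw [Real.rpow_add_one hξ.ne']
  simp only [zero_mul, neg_zero, Real.exp_zero, mul_one]
  nlinarith [mul_le_mul_of_nonneg_left h3 h4]

/-- The average rate, up to the factor `2 π dens`, as an integral in `[0, ∞]`; `η` is the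
inverse of the SNR. -/
noncomputable def rateLIntegral (α dens : ℝ) (ν₀ νI : Measure ℝ) (η : ℝ) : ℝ≥0∞ :=
  ∫⁻ z in Ioi 0, ENNReal.ofReal ((1 - gainMGF ν₀ z) / z) *
    distanceIntegral α η (Real.pi * dens * Z α νI z) z

/-- The distance density supplies the missing `exp (-π dens ξ ^ 2)`, turning the exponent `Z - 1`
into `Z`. -/
lemma lintegral_distance_mul_lintegral_rateIntegrand (hν₀ : IsGainLaw ν₀) (hνI : IsGainLaw νI)
    (hα : 2 < α) (η : ℝ) :
    ∫⁻ ξ in Ioi 0, ENNReal.ofReal (ξ * Real.exp (-Real.pi * dens * ξ ^ 2)) *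
        ∫⁻ z in Ioi 0, ENNReal.ofReal (rateIntegrand α dens ν₀ νI η ξ z) =
      rateLIntegral α dens ν₀ νI η := by
  simp_rw [← lintegral_const_mul' _ _ ENNReal.ofReal_ne_top]
  rw [lintegral_lintegral_swap]
  · refine setLIntegral_congr_fun measurableSet_Ioi fun z hz => ?_
    have hz : 0 < z := hz
    have hM := hν₀.gainMGF_le_one hz.le
    have hK : 0 ≤ (1 - gainMGF ν₀ z) / z := div_nonneg (by linarith) hz.le
    rw [distanceIntegral, ← lintegral_const_mul' _ _ ENNReal.ofReal_ne_top]
    refine setLIntegral_congr_fun measurableSet_Ioi fun ξ hξ => ?_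
    have hξ : 0 < ξ := hξ
    rw [← ENNReal.ofReal_mul (by positivity), ← ENNReal.ofReal_mul hK]
    congr 1
    have : Real.exp (-(Real.pi * dens * Z α νI z * ξ ^ 2)) =
        Real.exp (-Real.pi * dens * ξ ^ 2) *
          Real.exp (-(Real.pi * dens * ξ ^ 2 * (Z α νI z - 1))) := by
      rw [← Real.exp_add]; ring_nf
    rw [rateIntegrand, this]
    ring
  · have := aemeasurable_rateIntegrand (dens := dens) hν₀ hνI hα η
    refine AEMeasurable.mul (Measurable.aemeasurable ?_) this.ennreal_ofReal
    fun_prop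

lemma rateLimit_nonneg (hν₀ : IsGainLaw ν₀) (hνI : IsGainLaw νI) (hα : 2 < α) :
    0 ≤ rateLimit α ν₀ νI := by
  refine setIntegral_nonneg measurableSet_Ioi fun z hz => ?_
  have hz : 0 < z := hz
  exact div_nonneg (div_nonneg (by linarith [hν₀.gainMGF_le_one hz.le])
    (by linarith [hνI.one_le_Z hα hz])) hz.le

lemma rateLIntegral_zero (hν₀ : IsGainLaw ν₀) (hνI : IsGainLaw νI) (hα : 2 < α) (hd : 0 < dens) :
    rateLIntegral α dens ν₀ νI 0 =
      ENNReal.ofReal (1 / (2 * Real.pi * dens) * rateLimit α ν₀ νI) := by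
  rw [rateLimit, ← integral_const_mul, ofReal_integral_eq_lintegral_ofReal
    ((integrableOn_rateLimit hν₀ hνI hα).const_mul _)]
  · refine setLIntegral_congr_fun measurableSet_Ioi fun z hz => ?_
    have hz : 0 < z := hz
    have hM := hν₀.gainMGF_le_one hz.le
    have hZ : 0 < Z α νI z := by linarith [hνI.one_le_Z hα hz]
    rw [distanceIntegral_zero z (by positivity),
      ← ENNReal.ofReal_mul (div_nonneg (by linarith) hz.le)]
    congr 1
    field_simp
  · filter_upwards [ae_restrict_mem measurableSet_Ioi] with z hz
    have hz : 0 < z := hz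
    exact mul_nonneg (by positivity) (div_nonneg (div_nonneg
      (by linarith [hν₀.gainMGF_le_one hz.le]) (by linarith [hνI.one_le_Z hα hz])) hz.le)

lemma rateLIntegral_le {η : ℝ} (hη : 0 ≤ η) :
    rateLIntegral α dens ν₀ νI η ≤ rateLIntegral α dens ν₀ νI 0 :=
  setLIntegral_mono' measurableSet_Ioi fun _ hz =>
    mul_le_mul_right (distanceIntegral_le hη (le_of_lt hz) _) _

lemma correction_nonneg (hν₀ : IsGainLaw ν₀) (hνI : IsGainLaw νI) (hα : 2 < α) {z : ℝ}
    (hz : 0 < z) : 0 ≤ (1 - gainMGF ν₀ z) / Z α νI z ^ (1 + α / 2) :=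
  div_nonneg (by linarith [hν₀.gainMGF_le_one hz.le])
    (Real.rpow_nonneg (by linarith [hνI.one_le_Z hα hz]) _)

/-- The linear error at `b = π dens Z z` carries a factor `z` that cancels `1 / z`; one factor `1 /
(π dens)` of `b ^ (-(1 + α / 2))` goes into the common prefactor. -/
lemma rateLIntegral_zero_le (hν₀ : IsGainLaw ν₀) (hνI : IsGainLaw νI) (hα : 2 < α)
    (hd : 0 < dens) {η : ℝ} (hη : 0 ≤ η) :
    rateLIntegral α dens ν₀ νI 0 ≤ rateLIntegral α dens ν₀ νI η +
      ENNReal.ofReal (1 / (2 * Real.pi * dens) *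
        ((Real.pi * dens) ^ (-(α / 2)) * Real.Gamma (1 + α / 2) * η *
          ∫ z in Ioi (0 : ℝ), (1 - gainMGF ν₀ z) / Z α νI z ^ (1 + α / 2))) := by
  have hG : 0 < Real.Gamma (1 + α / 2) := Real.Gamma_pos_of_pos (by linarith)
  rw [← mul_assoc, ← integral_const_mul, ofReal_integral_eq_lintegral_ofReal
    ((integrableOn_correction hν₀ hνI hα).const_mul _), rateLIntegral, rateLIntegral,
    ← lintegral_add_right']
  · refine setLIntegral_mono' measurableSet_Ioi fun z hz => ?_
    have hz : 0 < z := hz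
    have hM := hν₀.gainMGF_le_one hz.le
    have hK : 0 ≤ (1 - gainMGF ν₀ z) / z := div_nonneg (by linarith) hz.le
    have hZ : 0 < Z α νI z := by linarith [hνI.one_le_Z hα hz]
    have hb : 0 < Real.pi * dens := by positivity
    refine (mul_le_mul_right (distanceIntegral_zero_le hα hη hz.le
      (mul_pos hb hZ)) _).trans (le_of_eq ?_)
    rw [mul_add, ← ENNReal.ofReal_mul hK]
    congr 2
    rw [Real.mul_rpow hb.le hZ.le, Real.rpow_neg hZ.le,
      show -(1 + α / 2) = -(α / 2) - 1 by ring, Real.rpow_sub_one hb.ne']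
    field_simp
  · have := (integrableOn_correction hν₀ hνI hα).aestronglyMeasurable.aemeasurable
    exact (this.const_mul _).ennreal_ofReal
  · filter_upwards [ae_restrict_mem measurableSet_Ioi] with z hz
    exact mul_nonneg (by positivity) (correction_nonneg hν₀ hνI hα hz)

lemma tendsto_highSNRRate :
    Tendsto (highSNRRate α dens ν₀ νI) atTop (𝓝 (rateLimit α ν₀ νI)) := by
  have h : Tendsto (fun snr : ℝ => 1 / snr) atTop (𝓝 0) := by
    simpa only [one_div] using tendsto_inv_atTop_zero
  unfold highSNRRate
  simpa using (tendsto_const_nhds (x := rateLimit α ν₀ νI)).sub ((h.const_mul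
    ((Real.pi * dens) ^ (-(α / 2)) * Real.Gamma (1 + α / 2))).mul_const
    (∫ z in Ioi (0 : ℝ), (1 - gainMGF ν₀ z) / Z α νI z ^ (1 + α / 2)))

end Closed

variable {Ω : Type*} [MeasurableSpace Ω] {μ : Measure Ω} {α dens : ℝ} {ν₀ νI : Measure ℝ}
  {X : ℕ → Ω → Plane} {g : ℕ → Ω → ℝ} {g₀ : Ω → ℝ} {P noise ξ : ℝ}

lemma log_one_add_sinr_nonneg {Ω : Type*} {X : ℕ → Ω → Plane} {g : ℕ → Ω → ℝ} {g₀ : Ω → ℝ}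
    (ω : Ω) : 0 ≤ Real.log (1 + sinr α P noise ξ X g g₀ ω) :=
  Real.log_nonneg (le_add_of_nonneg_right ENNReal.toReal_nonneg)

lemma conditionalRate_nonneg : 0 ≤ conditionalRate μ α P noise X g g₀ ξ :=
  integral_nonneg log_one_add_sinr_nonneg

lemma averageRate_nonneg (hd : 0 < dens) : 0 ≤ averageRate μ α dens P noise X g g₀ := by
  refine mul_nonneg (by positivity) (setIntegral_nonneg measurableSet_Ioi fun ξ hξ => ?_)
  have hξ : 0 < ξ := hξ
  exact mul_nonneg (by positivity) conditionalRate_nonneg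

namespace IsSingleTierNetwork

variable [IsProbabilityMeasure μ]

lemma integrable_log_one_add_sinr (hnet : IsSingleTierNetwork μ dens ν₀ νI X g g₀)
    (hν₀ : IsGainLaw ν₀) (hνI : IsGainLaw νI) (hα : 2 < α) (hd : 0 < dens)
    (hP : 0 < P) (hn : 0 ≤ noise) (hξ : 0 < ξ) :
    Integrable (fun ω => Real.log (1 + sinr α P noise ξ X g g₀ ω)) μ := by
  have hXm : Measurable fun ω => ((fun n => X n ω), (fun n => g n ω)) :=
    (measurable_pi_lambda _ hnet.ppp.measurable).prodMk
      (measurable_pi_lambda _ hnet.gain_measurable)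
  have hRm := (measurable_relInterference α ξ).comp hXm
  have hs : Measurable (sinr α P noise ξ X g g₀) := by
    simp_rw [funext (sinr_eq (X := X) (g := g) (g₀ := g₀) hP hn hξ)]
    exact (hnet.serving_measurable.ennreal_ofReal.div (measurable_const.add hRm)).ennreal_toReal
  refine ⟨(Real.measurable_log.comp (hs.const_add 1)).aestronglyMeasurable, ?_⟩
  rw [hasFiniteIntegral_iff_ofReal (ae_of_all _ log_one_add_sinr_nonneg),
    hnet.lintegral_log_one_add_sinr hν₀ hνI hα hd hP hn hξ]
  exact lintegral_rateIntegrand_lt_top hν₀ hνI hα hd (by positivity) hξ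

lemma ofReal_conditionalRate (hnet : IsSingleTierNetwork μ dens ν₀ νI X g g₀)
    (hν₀ : IsGainLaw ν₀) (hνI : IsGainLaw νI) (hα : 2 < α) (hd : 0 < dens)
    (hP : 0 < P) (hn : 0 ≤ noise) (hξ : 0 < ξ) :
    ENNReal.ofReal (conditionalRate μ α P noise X g g₀ ξ) =
      ∫⁻ z in Ioi 0, ENNReal.ofReal (rateIntegrand α dens ν₀ νI (noise / P) ξ z) := by
  rw [conditionalRate, ofReal_integral_eq_lintegral_ofReal
    (hnet.integrable_log_one_add_sinr hν₀ hνI hα hd hP hn hξ) (ae_of_all _ log_one_add_sinr_nonneg),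
    hnet.lintegral_log_one_add_sinr hν₀ hνI hα hd hP hn hξ]

lemma lintegral_conditionalRate (hnet : IsSingleTierNetwork μ dens ν₀ νI X g g₀)
    (hν₀ : IsGainLaw ν₀) (hνI : IsGainLaw νI) (hα : 2 < α) (hd : 0 < dens)
    (hP : 0 < P) (hn : 0 ≤ noise) :
    ∫⁻ ξ in Ioi 0, ENNReal.ofReal (ξ * Real.exp (-Real.pi * dens * ξ ^ 2) *
      conditionalRate μ α P noise X g g₀ ξ) = rateLIntegral α dens ν₀ νI (noise / P) := by
  rw [← lintegral_distance_mul_lintegral_rateIntegrand hν₀ hνI hα]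
  refine setLIntegral_congr_fun measurableSet_Ioi fun ξ hξ => ?_
  have hξ : 0 < ξ := hξ
  rw [ENNReal.ofReal_mul (by positivity), hnet.ofReal_conditionalRate hν₀ hνI hα hd hP hn hξ]

lemma integrableOn_conditionalRate (hnet : IsSingleTierNetwork μ dens ν₀ νI X g g₀)
    (hν₀ : IsGainLaw ν₀) (hνI : IsGainLaw νI) (hα : 2 < α) (hd : 0 < dens)
    (hP : 0 < P) (hn : 0 ≤ noise) :
    IntegrableOn (fun ξ => ξ * Real.exp (-Real.pi * dens * ξ ^ 2) *
      conditionalRate μ α P noise X g g₀ ξ) (Ioi (0 : ℝ)) := by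
  -- Measurability in `ξ` comes from the integral representation, whose integrand is jointly
  -- measurable almost everywhere.
  have hm : AEMeasurable (conditionalRate μ α P noise X g g₀) (volume.restrict (Ioi 0)) := by
    have := (aemeasurable_rateIntegrand (dens := dens) hν₀ hνI hα
      (noise / P)).ennreal_ofReal.lintegral_prod_right'.ennreal_toReal
    refine this.congr ?_
    filter_upwards [ae_restrict_mem measurableSet_Ioi] with ξ hξ
    rw [← ENNReal.toReal_ofReal (conditionalRate_nonneg (μ := μ) (α := α) (P := P)
      (noise := noise) (X := X) (g := g) (g₀ := g₀) (ξ := ξ)),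
      hnet.ofReal_conditionalRate hν₀ hνI hα hd hP hn hξ]
    rfl
  refine ⟨(AEMeasurable.mul (by fun_prop) hm).aestronglyMeasurable, ?_⟩
  rw [hasFiniteIntegral_iff_ofReal, hnet.lintegral_conditionalRate hν₀ hνI hα hd hP hn]
  · refine (rateLIntegral_le (by positivity)).trans_lt ?_
    rw [rateLIntegral_zero hν₀ hνI hα hd]
    exact ENNReal.ofReal_lt_top
  · filter_upwards [ae_restrict_mem measurableSet_Ioi] with ξ hξ
    have hξ : 0 < ξ := hξ
    exact mul_nonneg (by positivity) conditionalRate_nonneg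

/-- The bridge back to real numbers: comparisons of `rateLIntegral` become comparisons of average
rates. -/
lemma ofReal_averageRate (hnet : IsSingleTierNetwork μ dens ν₀ νI X g g₀)
    (hν₀ : IsGainLaw ν₀) (hνI : IsGainLaw νI) (hα : 2 < α) (hd : 0 < dens)
    (hP : 0 < P) (hn : 0 ≤ noise) :
    ENNReal.ofReal (1 / (2 * Real.pi * dens) * averageRate μ α dens P noise X g g₀) =
      rateLIntegral α dens ν₀ νI (noise / P) := by
  rw [averageRate, ← mul_assoc, one_div_mul_cancel (by positivity), one_mul,
    ofReal_integral_eq_lintegral_ofReal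
      (hnet.integrableOn_conditionalRate hν₀ hνI hα hd hP hn),
    hnet.lintegral_conditionalRate hν₀ hνI hα hd hP hn]
  filter_upwards [ae_restrict_mem measurableSet_Ioi] with ξ hξ
  have hξ : 0 < ξ := hξ
  exact mul_nonneg (by positivity) conditionalRate_nonneg

lemma averageRate_zero (hnet : IsSingleTierNetwork μ dens ν₀ νI X g g₀)
    (hν₀ : IsGainLaw ν₀) (hνI : IsGainLaw νI) (hα : 2 < α) (hd : 0 < dens) (hP : 0 < P) :
    averageRate μ α dens P 0 X g g₀ = rateLimit α ν₀ νI := by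
  have h := hnet.ofReal_averageRate hν₀ hνI hα hd hP le_rfl
  have hc : 0 < 1 / (2 * Real.pi * dens) := by positivity
  rw [zero_div, rateLIntegral_zero hν₀ hνI hα hd, ENNReal.ofReal_eq_ofReal_iff
    (mul_nonneg hc.le (averageRate_nonneg hd))
    (mul_nonneg hc.le (rateLimit_nonneg hν₀ hνI hα))] at h
  exact mul_left_cancel₀ hc.ne' h

lemma averageRate_le (hnet : IsSingleTierNetwork μ dens ν₀ νI X g g₀)
    (hν₀ : IsGainLaw ν₀) (hνI : IsGainLaw νI) (hα : 2 < α) (hd : 0 < dens)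
    (hP : 0 < P) (hn : 0 ≤ noise) :
    averageRate μ α dens P noise X g g₀ ≤ rateLimit α ν₀ νI := by
  have h := rateLIntegral_le (α := α) (dens := dens) (ν₀ := ν₀) (νI := νI) (η := noise / P)
    (by positivity)
  have hc : 0 < 1 / (2 * Real.pi * dens) := by positivity
  rw [← hnet.ofReal_averageRate hν₀ hνI hα hd hP hn, rateLIntegral_zero hν₀ hνI hα hd,
    ENNReal.ofReal_le_ofReal_iff (mul_nonneg hc.le (rateLimit_nonneg hν₀ hνI hα))] at h
  exact le_of_mul_le_mul_left h hc

lemma highSNRRate_le (hnet : IsSingleTierNetwork μ dens ν₀ νI X g g₀)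
    (hν₀ : IsGainLaw ν₀) (hνI : IsGainLaw νI) (hα : 2 < α) (hd : 0 < dens)
    (hP : 0 < P) (hn : 0 ≤ noise) :
    highSNRRate α dens ν₀ νI (P / noise) ≤ averageRate μ α dens P noise X g g₀ := by
  have h := rateLIntegral_zero_le hν₀ hνI hα hd (η := noise / P) (by positivity)
  have hc : 0 < 1 / (2 * Real.pi * dens) := by positivity
  have hG : 0 < Real.Gamma (1 + α / 2) := Real.Gamma_pos_of_pos (by linarith)
  have hC : 0 ≤ (Real.pi * dens) ^ (-(α / 2)) * Real.Gamma (1 + α / 2) * (noise / P) *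
      ∫ z in Ioi (0 : ℝ), (1 - gainMGF ν₀ z) / Z α νI z ^ (1 + α / 2) :=
    mul_nonneg (by positivity) (setIntegral_nonneg measurableSet_Ioi fun z hz =>
      correction_nonneg hν₀ hνI hα hz)
  have hA := averageRate_nonneg (μ := μ) (α := α) (P := P) (noise := noise) (X := X) (g := g)
    (g₀ := g₀) hd
  rw [← hnet.ofReal_averageRate hν₀ hνI hα hd hP hn, rateLIntegral_zero hν₀ hνI hα hd,
    ← ENNReal.ofReal_add (mul_nonneg hc.le hA) (mul_nonneg hc.le hC), ← mul_add,
    ENNReal.ofReal_le_ofReal_iff (mul_nonneg hc.le (add_nonneg hA hC))] at h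
  have h := le_of_mul_le_mul_left h hc
  rw [highSNRRate, one_div_div]
  linarith

/-- A squeeze between the two bounds, with the noise chosen as `P / snr` so that `P / noise` is
`snr`. -/
lemma tendsto_averageRate (hnet : IsSingleTierNetwork μ dens ν₀ νI X g g₀)
    (hν₀ : IsGainLaw ν₀) (hνI : IsGainLaw νI) (hα : 2 < α) (hd : 0 < dens) (hP : 0 < P) :
    Tendsto (fun snr : ℝ => averageRate μ α dens P (P / snr) X g g₀) atTop
      (𝓝 (rateLimit α ν₀ νI)) := by
  refine tendsto_of_tendsto_of_tendsto_of_le_of_le' (tendsto_highSNRRate (dens := dens))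
    tendsto_const_nhds ?_ ?_
  all_goals filter_upwards [eventually_gt_atTop 0] with snr hsnr
  · have := hnet.highSNRRate_le hν₀ hνI hα hd hP (noise := P / snr) (by positivity)
    rwa [div_div_cancel₀ hP.ne'] at this
  · exact hnet.averageRate_le hν₀ hνI hα hd hP (by positivity)

end IsSingleTierNetwork

end AverageRate

end CellularRate

theorem corollary4 {Ω : Type*} [MeasurableSpace Ω] (μ : Measure Ω) [IsProbabilityMeasure μ]
    (α dens : ℝ) (hα : 2 < α) (hdens : 0 < dens)
    (ν₀ νI : Measure ℝ) (hν₀ : CellularRate.IsGainLaw ν₀) (hνI : CellularRate.IsGainLaw νI)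
    (X : ℕ → Ω → CellularRate.Plane) (g : ℕ → Ω → ℝ) (g₀ : Ω → ℝ)
    (hnet : CellularRate.IsSingleTierNetwork μ dens ν₀ νI X g g₀) :
    -- the series and the integrals of the two closed forms converge
    (∀ y : ℝ, 0 < y → Summable (CellularRate.seriesTerm α νI y)) ∧
    IntegrableOn (fun z => (1 - CellularRate.gainMGF ν₀ z) / CellularRate.Z α νI z / z)
      (Ioi (0 : ℝ)) ∧
    IntegrableOn
      (fun z => (1 - CellularRate.gainMGF ν₀ z) / CellularRate.Z α νI z ^ (1 + α / 2))
      (Ioi (0 : ℝ)) ∧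
    -- the average rate is well defined and finite, with and without noise
    (∀ P noise : ℝ, 0 < P → 0 ≤ noise →
      (∀ ξ : ℝ, 0 < ξ →
        Integrable (fun ω => Real.log (1 + CellularRate.sinr α P noise ξ X g g₀ ω)) μ) ∧
      IntegrableOn
        (fun ξ => ξ * Real.exp (-Real.pi * dens * ξ ^ 2) *
          CellularRate.conditionalRate μ α P noise X g g₀ ξ) (Ioi (0 : ℝ))) ∧
    -- the upper bound is the average rate without noise
    (∀ P : ℝ, 0 < P →
      CellularRate.averageRate μ α dens P 0 X g g₀ = CellularRate.rateLimit α ν₀ νI) ∧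
    -- the bounds, as functions of the SNR
    (∀ P noise : ℝ, 0 < P → 0 < noise →
      CellularRate.highSNRRate α dens ν₀ νI (P / noise)
          ≤ CellularRate.averageRate μ α dens P noise X g g₀ ∧
        CellularRate.averageRate μ α dens P noise X g g₀ ≤ CellularRate.rateLimit α ν₀ νI) ∧
    -- the lower bound is a high-SNR approximation: both have the same limit
    Tendsto (CellularRate.highSNRRate α dens ν₀ νI) atTop
      (𝓝 (CellularRate.rateLimit α ν₀ νI)) ∧
    (∀ P : ℝ, 0 < P →
      Tendsto (fun snr : ℝ => CellularRate.averageRate μ α dens P (P / snr) X g g₀) atTop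
        (𝓝 (CellularRate.rateLimit α ν₀ νI))) := by
  refine ⟨fun y hy => hνI.summable_seriesTerm hα hy,
    CellularRate.integrableOn_rateLimit hν₀ hνI hα,
    CellularRate.integrableOn_correction hν₀ hνI hα, fun P noise hP hn => ⟨fun ξ hξ =>
      hnet.integrable_log_one_add_sinr hν₀ hνI hα hdens hP hn hξ,
      hnet.integrableOn_conditionalRate hν₀ hνI hα hdens hP hn⟩,
    fun P hP => hnet.averageRate_zero hν₀ hνI hα hdens hP,
    fun P noise hP hn => ⟨hnet.highSNRRate_le hν₀ hνI hα hdens hP hn.le,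
      hnet.averageRate_le hν₀ hνI hα hdens hP hn.le⟩,
    CellularRate.tendsto_highSNRRate,
    fun P hP => hnet.tendsto_averageRate hν₀ hνI hα hdens hP⟩
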